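/- For a measurable function $p(\cdot):\mathbb{R}^2\to[1,\infty)$ let $L^{p(\cdot)}(\mathbb{R}^2)$ be the space of measurable functions $f$ with $\int_{\mathbb{R}^2}(|f(x)|/\lambda)^{p(x)}\,dx<\infty$ for some $\lambda>0$, with the norm $$\|f\|_{p(\cdot)}=\inf\Big\{\lambda>0:\int_{\mathbb{R}^2}\Big(\frac{|f(x)|}{\lambda}\Big)^{p(x)}dx\le 1\Big\},$$ and put $p_-=\operatorname{ess\,inf}_{x\in\mathbb{R}^2}p(x)$, $p_+=\operatorname{ess\,sup}_{x\in\mathbb{R}^2}p(x)$. For real $N\ge 2$ let $\mathcal{B}_N$ be the set of all rectangles in $\mathbb{R}^2$ (of any position, direction and size) whose ratio of long side to short side equals $N$, and let $$K_Nf(x)=\sup_{x\in R\in\mathcal{B}_N}\frac{1}{|R|}\int_R|f(y)|\,dy$$ be the Kakeya (Nikodym) maximal operator. Theorem. Let $2\le p_-\le p_+<\infty$, and let $p(\infty)$, $c_\infty$ be real numbers. There is a constant $C>0$, depending only on $p_-$, $p_+$, $p(\infty)$ and $c_\infty$ (in particular independent of $N$), such that the following holds for every real $N\ge 2$. Let $p(\cdot):\mathbb{R}^2\to[1,\infty)$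 be a measurable function with essential infimum $p_-$ and essential supremum $p_+$ that is - log-Hölder continuous at infinity: $|p(x)-p(\infty)|\log(e+|x|)\le c_\infty$ for all $x\in\mathbb{R}^2$, and - $N$-modified locally log-Hölder continuous with a constant $c_N>0$: $\displaystyle\Big|\frac1{p(x)}-\frac1{p(y)}\Big|\log\Big(\frac{N}{|x-y|^2}\Big)\le c_N\log N$ for all $x\neq y$ in $\mathbb{R}^2$ with $|x-y|<\sqrt N$. Then $K_N$ is bounded from $L^{p(\cdot)}(\mathbb{R}^2)$ to $L^{p(\cdot)}(\mathbb{R}^2)$, and $$\|K_N\|_{L^{p(\cdot)}(\mathbb{R}^2)\to L^{p(\cdot)}(\mathbb{R}^2)}\le C\,N^{p_-c_N}(\log N)^{2/p_-}.$$ -/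

import Mathlib

open MeasureTheory
open scoped ENNReal NNReal

noncomputable section

/-- The Euclidean plane. -/
abbrev Plane : Type := EuclideanSpace ℝ (Fin 2)

/-- The modular `ρ_{p(·)}(f / lam) = ∫ (|f(x)| / lam)^{p(x)} dx`, for functions with real or
extended nonnegative values. -/
def varModular {ε : Type*} [ENorm ε] (p : Plane → ℝ) (f : Plane → ε) (lam : ℝ≥0) : ℝ≥0∞ :=
  ∫⁻ x, (‖f x‖ₑ / (lam : ℝ≥0∞)) ^ (p x)

/-- `f ∈ L^{p(·)}(ℝ²)`: `f` is Lebesgue measurable and `ρ_{p(·)}(f / lam) < ∞` for some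
`lam > 0`. -/
def MemVarLp {ε : Type*} [TopologicalSpace ε] [ENorm ε] (p : Plane → ℝ) (f : Plane → ε) : Prop :=
  AEStronglyMeasurable f volume ∧ ∃ lam : ℝ≥0, 0 < lam ∧ varModular p f lam < ∞

/-- The (Luxemburg) norm `inf {lam > 0 : ρ_{p(·)}(f / lam) ≤ 1}`, equal to `∞` when there is no
such finite `lam`. -/
def varLpNorm {ε : Type*} [ENorm ε] (p : Plane → ℝ) (f : Plane → ε) : ℝ≥0∞ :=
  ⨅ (lam : ℝ≥0) (_ : 0 < lam) (_ : varModular p f lam ≤ 1), (lam : ℝ≥0∞)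

/-- The operator `T` is bounded from `L^{p(·)}(ℝ²)` to `L^{p(·)}(ℝ²)`. -/
def BoundedOnVarLp (p : Plane → ℝ) (T : (Plane → ℝ) → Plane → ℝ≥0∞) : Prop :=
  ∃ A : ℝ≥0, ∀ f : Plane → ℝ, MemVarLp p f →
    MemVarLp p (T f) ∧ varLpNorm p (T f) ≤ A * varLpNorm p f

/-- The operator norm of `T : L^{p(·)}(ℝ²) → L^{p(·)}(ℝ²)`, the infimum of all the finite `A` with
`‖T f‖ ≤ A ‖f‖` for all `f ∈ L^{p(·)}(ℝ²)`. -/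
def varLpOpNorm (p : Plane → ℝ) (T : (Plane → ℝ) → Plane → ℝ≥0∞) : ℝ≥0∞ :=
  ⨅ (A : ℝ≥0) (_ : ∀ f : Plane → ℝ, MemVarLp p f → varLpNorm p (T f) ≤ A * varLpNorm p f),
    (A : ℝ≥0∞)

/-- The closed rectangle with centre `c`, with long sides of length `N * a` in the direction `b 0`
and short sides of length `a` in the direction `b 1`. -/
def planeRectangle (N : ℝ) (c : Plane) (b : OrthonormalBasis (Fin 2) ℝ Plane) (a : ℝ) :
    Set Plane :=
  {x | |inner ℝ (b 0) (x - c)| ≤ N * a / 2 ∧ |inner ℝ (b 1) (x - c)| ≤ a / 2}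

/-- The family of all rectangles in the plane (any position, direction and size) of
eccentricity `N`. -/
def eccRectangles (N : ℝ) : Set (Set Plane) :=
  {R | ∃ (c : Plane) (b : OrthonormalBasis (Fin 2) ℝ Plane) (a : ℝ),
    0 < a ∧ R = planeRectangle N c b a}

/-- The Kakeya (Nikodym) maximal operator: the supremum of the averages of `|f|` over the
rectangles of eccentricity `N` that contain the point. -/
def kakeyaMaximal (N : ℝ) (f : Plane → ℝ) (x : Plane) : ℝ≥0∞ :=
  ⨆ (R : Set Plane) (_ : R ∈ eccRectangles N) (_ : x ∈ R), ⨍⁻ y in R, ‖f y‖ₑ ∂volume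

/-- `p_-`, the essential infimum of `p`. -/
def expInf (p : Plane → ℝ) : EReal := essInf (fun x => (p x : EReal)) volume

/-- `p_+`, the essential supremum of `p`. -/
def expSup (p : Plane → ℝ) : EReal := essSup (fun x => (p x : EReal)) volume

/-- `p` is log-Hölder continuous at infinity, with limit value `pinf` and constant `cinf`. -/
def LogHolderAtInfinity (p : Plane → ℝ) (pinf cinf : ℝ) : Prop :=
  ∀ x : Plane, |p x - pinf| * Real.log (Real.exp 1 + ‖x‖) ≤ cinf

/-- `p` is `N`-modified locally log-Hölder continuous, with the constant `cN > 0`. -/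
def ModifiedLogHolder (N : ℝ) (p : Plane → ℝ) (cN : ℝ) : Prop :=
  0 < cN ∧ ∀ x y : Plane, ‖x - y‖ < Real.sqrt N →
    |1 / p x - 1 / p y| * Real.log (N / ‖x - y‖ ^ 2) ≤ cN * Real.log N

end

/-! The constant-exponent estimate comes from Córdoba's overlap argument. For weak type (2,2), a
finite family of rectangles is tested against weights `|E i| / |R i|`, where the `E i` are disjoint
pieces of the union. The square of the L² norm of the dual function is a double sum of overlaps,
reduced by symmetry to pairs whose second rectangle is the smaller. A smaller rectangle through `x`
that meets `R` must be tilted by an angle proportional to the distance of `x` from `R`, so its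
overlap is bounded by a kernel of mass `O(|R| log N)` (`volume_inter_le_overlapKernel`,
`lintegral_overlapKernel_le`, `sum_overlap_le`).

Weak type (1,1) with the crude constant `O(N)` follows from Vitali's lemma. Using it only on values
of `f` above `N * s` cancels the factor `N`. The values between `s / 2` and `N * s` cost one more
logarithm, so the squared L² bound is `O(log² N)` (`lintegral_rectMaximal_sq_le`). Jensen's
inequality carries this constant to the integral of `(K f)^p` for every `p ≥ 2`, so the norm has
order `(log N)^(2/p)`.

For a variable exponent, normalise the modular to be at most one and split `f` at height one. For
large values, compare on each rectangle `R` with the least exponent `p y` there. Jensen's inequality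
and the modular bound lose only `|R|^(-(1/p y - 1/p x) * p x)`. Since the squared diameter of `R` is
comparable to `N * |R|`, the modified log-Hölder condition bounds this by `(5/4 * N^cN)^(p x)`
(`inv_area_rpow_le`, `rectMaximal_rpow_le_of_large`). What remains is a maximal function with the
constant exponent `pm`. For small values, decay at infinity permits replacing `p x` by `pinf` at the
price of an integrable error (`rpow_le_mul_rpow_add_of_le_one`). Dividing by a multiple of `(log
N)^(2/pm)` absorbs the factor `log² N`. -/

noncomputable section

/-! ### Rectangles in orthonormal coordinates. -/

/-- The coordinates of a point in the frame with origin `c` and axes `b`. -/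
def frameCoords (c : Plane) (b : OrthonormalBasis (Fin 2) ℝ Plane) (x : Plane) : ℝ × ℝ :=
  (inner ℝ (b 0) (x - c), inner ℝ (b 1) (x - c))

theorem measurePreserving_frameCoords (c : Plane) (b : OrthonormalBasis (Fin 2) ℝ Plane) :
    MeasurePreserving (frameCoords c b) volume volume := by
  have h1 : MeasurePreserving (fun x : Plane => x - c) volume volume :=
    measurePreserving_sub_right volume c
  have h := (volume_preserving_finTwoArrow ℝ).comp
    ((PiLp.volume_preserving_ofLp (Fin 2)).comp (b.measurePreserving_repr.comp h1))
  convert h using 1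
  ext x <;> simp [frameCoords, OrthonormalBasis.repr_apply_apply, MeasurableEquiv.finTwoArrow,
    MeasurableEquiv.piFinTwo, inner_sub_right]

theorem continuous_frameCoords (c : Plane) (b : OrthonormalBasis (Fin 2) ℝ Plane) :
    Continuous (frameCoords c b) := by
  unfold frameCoords; fun_prop

theorem planeRectangle_eq_preimage (N : ℝ) (c : Plane) (b : OrthonormalBasis (Fin 2) ℝ Plane)
    (a : ℝ) : planeRectangle N c b a =
      frameCoords c b ⁻¹' (Metric.closedBall 0 (N * a / 2) ×ˢ Metric.closedBall 0 (a / 2)) := by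
  ext x
  simp [planeRectangle, frameCoords]

theorem isClosed_planeRectangle (N : ℝ) (c : Plane) (b : OrthonormalBasis (Fin 2) ℝ Plane)
    (a : ℝ) : IsClosed (planeRectangle N c b a) := by
  rw [planeRectangle_eq_preimage]
  exact (Metric.isClosed_closedBall.prod Metric.isClosed_closedBall).preimage
    (continuous_frameCoords c b)

theorem measurableSet_planeRectangle (N : ℝ) (c : Plane) (b : OrthonormalBasis (Fin 2) ℝ Plane)
    (a : ℝ) : MeasurableSet (planeRectangle N c b a) :=
  (isClosed_planeRectangle N c b a).measurableSet

theorem volume_planeRectangle {N a : ℝ} (hN : 0 ≤ N) (ha : 0 ≤ a) (c : Plane)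
    (b : OrthonormalBasis (Fin 2) ℝ Plane) :
    volume (planeRectangle N c b a) = ENNReal.ofReal (N * a ^ 2) := by
  rw [planeRectangle_eq_preimage, (measurePreserving_frameCoords c b).measure_preimage
    (Metric.isClosed_closedBall.prod Metric.isClosed_closedBall).measurableSet.nullMeasurableSet,
    Measure.volume_eq_prod, Measure.prod_prod, Real.volume_closedBall, Real.volume_closedBall,
    ← ENNReal.ofReal_mul (by positivity)]
  congr 1; ring

theorem sub_eq_frameCoords (c : Plane) (b : OrthonormalBasis (Fin 2) ℝ Plane) (x : Plane) :
    x - c = (frameCoords c b x).1 • b 0 + (frameCoords c b x).2 • b 1 := by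
  have := b.sum_repr' (x - c)
  rw [Fin.sum_univ_two] at this
  exact this.symm

theorem norm_sub_sq_eq_frameCoords (c : Plane) (b : OrthonormalBasis (Fin 2) ℝ Plane) (x : Plane) :
    ‖x - c‖ ^ 2 = (frameCoords c b x).1 ^ 2 + (frameCoords c b x).2 ^ 2 := by
  have := b.sum_sq_norm_inner_right (x - c)
  rw [Fin.sum_univ_two] at this
  rw [← this]; simp [frameCoords]

theorem planeRectangle_subset_closedBall {N a : ℝ} (hN : 1 ≤ N) (ha : 0 ≤ a) (c : Plane)
    (b : OrthonormalBasis (Fin 2) ℝ Plane) :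
    planeRectangle N c b a ⊆ Metric.closedBall c (N * a) := by
  intro x hx
  rw [planeRectangle_eq_preimage] at hx
  simp only [Set.mem_preimage, Set.mem_prod, mem_closedBall_zero_iff, Real.norm_eq_abs] at hx
  rw [mem_closedBall_iff_norm]
  have h := norm_sub_sq_eq_frameCoords c b x
  have h1 := sq_le_sq' (abs_le.1 hx.1).1 (abs_le.1 hx.1).2
  have h2 := sq_le_sq' (abs_le.1 hx.2).1 (abs_le.1 hx.2).2
  have h3 : a ≤ N * a := by nlinarith
  apply abs_le_of_sq_le_sq' _ (by positivity) |>.2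
  nlinarith

theorem norm_sub_sq_le_of_mem_planeRectangle {N a : ℝ} {c : Plane}
    {b : OrthonormalBasis (Fin 2) ℝ Plane} {x y : Plane}
    (hx : x ∈ planeRectangle N c b a) (hy : y ∈ planeRectangle N c b a) :
    ‖x - y‖ ^ 2 ≤ (N ^ 2 + 1) * a ^ 2 := by
  have h := norm_sub_sq_eq_frameCoords y b x
  have e : ∀ i, inner ℝ (b i) (x - y) = inner ℝ (b i) (x - c) - inner ℝ (b i) (y - c) := by
    intro i; rw [← inner_sub_right]; congr 1; abel
  have h0 : |inner ℝ (b 0) (x - y)| ≤ N * a := by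
    rw [e]; refine (abs_sub _ _).trans ?_; linarith [hx.1, hy.1]
  have h1 : |inner ℝ (b 1) (x - y)| ≤ a := by
    rw [e]; refine (abs_sub _ _).trans ?_; linarith [hx.2, hy.2]
  have h0' := sq_le_sq' (abs_le.1 h0).1 (abs_le.1 h0).2
  have h1' := sq_le_sq' (abs_le.1 h1).1 (abs_le.1 h1).2
  simp only [frameCoords] at h
  nlinarith

/-! ### Overlaps of rectangles and their logarithmic majorant. -/

/-- Two strips cross in a set whose area is inversely proportional to the angle between them. -/
theorem volume_inter_planeRectangle_le {N a a' : ℝ} (c c' : Plane)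
    (b b' : OrthonormalBasis (Fin 2) ℝ Plane) (ha : 0 ≤ a)
    (hs : inner ℝ (b 1) (b' 0) ≠ 0) :
    volume (planeRectangle N c b a ∩ planeRectangle N c' b' a') ≤
      ENNReal.ofReal (a * a' / |inner ℝ (b 1) (b' 0)|) := by
  set σ : ℝ := inner ℝ (b 1) (b' 0) with hσ
  set τ : ℝ := inner ℝ (b 1) (b' 1) with hτ
  set κ : ℝ := inner ℝ (b 1) (c' - c) with hκ
  -- Only the two short-side constraints matter: in the second frame, slices along `b' 0` have
  -- length at most `a / |σ|`, and the heights fill an interval of length `a'`.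
  set S : Set (ℝ × ℝ) := {p | |p.1 * σ + p.2 * τ + κ| ≤ a / 2 ∧ |p.2| ≤ a' / 2} with hS
  have hSc : IsClosed S := by
    have h1 : IsClosed {p : ℝ × ℝ | |p.1 * σ + p.2 * τ + κ| ≤ a / 2} :=
      isClosed_le (by fun_prop) (by fun_prop)
    have h2 : IsClosed {p : ℝ × ℝ | |p.2| ≤ a' / 2} := isClosed_le (by fun_prop) (by fun_prop)
    exact h1.inter h2
  have hsub : planeRectangle N c b a ∩ planeRectangle N c' b' a' ⊆ frameCoords c' b' ⁻¹' S := by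
    rintro x ⟨hx, hx'⟩
    refine ⟨?_, hx'.2⟩
    have e : x - c = (frameCoords c' b' x).1 • b' 0 + (frameCoords c' b' x).2 • b' 1 + (c' - c) := by
      rw [← sub_eq_frameCoords]; abel
    have h := hx.2
    rw [e, inner_add_right, inner_add_right, inner_smul_right, inner_smul_right] at h
    exact h
  refine (measure_mono hsub).trans ?_
  rw [(measurePreserving_frameCoords c' b').measure_preimage hSc.measurableSet.nullMeasurableSet,
    Measure.volume_eq_prod, Measure.prod_apply_symm hSc.measurableSet]
  have hσ0 : 0 < |σ| := abs_pos.2 hs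
  have hslice : ∀ y : ℝ, volume ((fun x => (x, y)) ⁻¹' S) ≤
      (Metric.closedBall (0 : ℝ) (a' / 2)).indicator (fun _ => ENNReal.ofReal (a / |σ|)) y := by
    intro y
    by_cases hy : |y| ≤ a' / 2
    · rw [Set.indicator_of_mem (by simpa using hy)]
      have : (fun x => (x, y)) ⁻¹' S ⊆ Metric.closedBall (-(y * τ + κ) / σ) (a / |σ| / 2) := by
        intro x hx
        have h := hx.1
        rw [Metric.mem_closedBall, Real.dist_eq]
        have e : x - -(y * τ + κ) / σ = (x * σ + y * τ + κ) / σ := by field_simp; ring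
        rw [e, abs_div, div_right_comm]
        gcongr
      refine (measure_mono this).trans ?_
      rw [Real.volume_closedBall]
      apply ENNReal.ofReal_le_ofReal; linarith
    · have : (fun x => (x, y)) ⁻¹' S = ∅ := by
        ext x; simp only [hS, Set.mem_preimage, Set.mem_ofPred_eq, Set.mem_empty_iff_false, hy,
          and_false]
      rw [this]; simp
  refine (lintegral_mono hslice).trans ?_
  rw [lintegral_indicator Metric.isClosed_closedBall.measurableSet, setLIntegral_const,
    Real.volume_closedBall, ← ENNReal.ofReal_mul (by positivity)]
  apply ENNReal.ofReal_le_ofReal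
  apply le_of_eq; field_simp

/-- A majorant, in frame coordinates, of the overlap of a rectangle with smaller rectangles
through a given point. -/
def overlapKernel (N a : ℝ) (q : ℝ × ℝ) : ℝ≥0∞ :=
  (Metric.closedBall (0 : ℝ) (3 * N * a)).indicator 1 q.1 *
    (Metric.closedBall (0 : ℝ) (3 * N * a)).indicator (fun t => ENNReal.ofReal (6 * a / (a + |t|))) q.2

/-- A common point `y` lies within `a / 2` of the long axis of the first rectangle. If `x` is at
distance `t > 3a` from that axis, moving from `y` to `x` inside the second rectangle forces the sine
`σ` of the angle to satisfy `t / 2 ≤ N * a' * |σ|`. The crossing area `a * a' / |σ|` is then at most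
`2a / t` times the area of the second rectangle. -/
theorem volume_inter_le_overlapKernel {N a a' : ℝ} (hN : 1 ≤ N) (ha' : 0 < a') (haa : a' ≤ a)
    (c c' : Plane) (b b' : OrthonormalBasis (Fin 2) ℝ Plane) {x : Plane}
    (hx : x ∈ planeRectangle N c' b' a') :
    volume (planeRectangle N c b a ∩ planeRectangle N c' b' a') ≤
      volume (planeRectangle N c' b' a') * overlapKernel N a (frameCoords c b x) := by
  rcases Set.eq_empty_or_nonempty (planeRectangle N c b a ∩ planeRectangle N c' b' a') with h | h
  · rw [h]; simp
  obtain ⟨y, hy, hy'⟩ := h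
  have ha : 0 < a := ha'.trans_le haa
  set σ : ℝ := inner ℝ (b 1) (b' 0) with hσ
  set s := (frameCoords y b' x).1
  set u := (frameCoords y b' x).2
  have e : ∀ i, inner ℝ (b' i) (x - y) = inner ℝ (b' i) (x - c') - inner ℝ (b' i) (y - c') := by
    intro i; rw [← inner_sub_right]; congr 1; abel
  have hs : |s| ≤ N * a' := by
    change |inner ℝ (b' 0) (x - y)| ≤ _
    rw [e]; refine (abs_sub _ _).trans ?_; linarith [hx.1, hy'.1]
  have hu : |u| ≤ a' := by
    change |inner ℝ (b' 1) (x - y)| ≤ _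
    rw [e]; refine (abs_sub _ _).trans ?_; linarith [hx.2, hy'.2]
  have hin : ∀ i j, |inner ℝ (b i) (b' j)| ≤ 1 := by
    intro i j
    simpa using abs_real_inner_le_norm (b i) (b' j)
  have ex : ∀ i, inner ℝ (b i) (x - c) = inner ℝ (b i) (y - c) + s * inner ℝ (b i) (b' 0)
      + u * inner ℝ (b i) (b' 1) := by
    intro i
    have : x - c = (y - c) + (s • b' 0 + u • b' 1) := by
      rw [← sub_eq_frameCoords]; abel
    rw [this, inner_add_right, inner_add_right, inner_smul_right, inner_smul_right]; ring
  have key : ∀ i, |inner ℝ (b i) (x - c)| ≤ |inner ℝ (b i) (y - c)| +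
      N * a' * |inner ℝ (b i) (b' 0)| + a' := by
    intro i
    rw [ex i]
    refine (abs_add_three _ _ _).trans ?_
    rw [abs_mul, abs_mul]
    have h1 := mul_le_mul_of_nonneg_right hs (abs_nonneg (inner ℝ (b i) (b' 0)))
    have h2 := mul_le_mul hu (hin i 1) (abs_nonneg _) ha'.le
    linarith
  have hNa : N * a' ≤ N * a := by gcongr
  have haN : a ≤ N * a := by nlinarith
  have h0 : |inner ℝ (b 0) (x - c)| ≤ 3 * N * a := by
    have := mul_le_mul_of_nonneg_left (hin 0 0) (by positivity : 0 ≤ N * a')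
    linarith [key 0, hy.1]
  have h1 : |inner ℝ (b 1) (x - c)| ≤ a / 2 + N * a' * |σ| + a' := by
    linarith [key 1, hy.2]
  have h1' : |inner ℝ (b 1) (x - c)| ≤ 3 * N * a := by
    have := mul_le_mul_of_nonneg_left (hin 1 0) (by positivity : 0 ≤ N * a')
    linarith
  have hk : overlapKernel N a (frameCoords c b x) =
      ENNReal.ofReal (6 * a / (a + |inner ℝ (b 1) (x - c)|)) := by
    unfold overlapKernel
    rw [Set.indicator_of_mem, Set.indicator_of_mem]
    · simp [frameCoords]
    · simpa [frameCoords] using h1'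
    · simpa [frameCoords] using h0
  rw [hk]
  set t := |inner ℝ (b 1) (x - c)| with ht
  have ht0 : 0 ≤ t := abs_nonneg _
  -- For `t ≤ 3a` the kernel value is at least one, so the trivial bound suffices. For `t > 3a`, the
  -- slack `a / 2 + a'` is at most `3a / 2 < t / 2`.
  rcases le_or_gt t (3 * a) with hta | hta
  · refine (measure_mono Set.inter_subset_right).trans (le_mul_of_one_le_right' ?_)
    rw [← ENNReal.ofReal_one]
    apply ENNReal.ofReal_le_ofReal
    rw [le_div_iff₀ (by positivity)]; linarith
  · have h2 : t / 2 ≤ N * a' * |σ| := by linarith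
    have hσ0 : 0 < |σ| := by
      by_contra hcon
      have : |σ| = 0 := le_antisymm (not_lt.1 hcon) (abs_nonneg _)
      rw [this] at h2; linarith
    refine (volume_inter_planeRectangle_le c c' b b' ha.le (abs_pos.1 hσ0)).trans ?_
    rw [volume_planeRectangle (by linarith) ha'.le, ← ENNReal.ofReal_mul (by positivity)]
    apply ENNReal.ofReal_le_ofReal
    rw [← hσ, div_le_iff₀ hσ0]
    have h3 : N * a' ^ 2 * (6 * a / (a + t)) * |σ| = (N * a' * |σ|) * (a' * (6 * a / (a + t))) := by
      ring
    rw [h3]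
    calc a * a' = t / 2 * (a' * (2 * a / t)) := by
          have : t ≠ 0 := by linarith
          field_simp
      _ ≤ N * a' * |σ| * (a' * (6 * a / (a + t))) := by
        gcongr ?_ * (a' * ?_)
        rw [div_le_div_iff₀ (by linarith) (by positivity)]
        nlinarith

theorem measurable_overlapKernel (N a : ℝ) : Measurable (overlapKernel N a) := by
  have h : MeasurableSet (Metric.closedBall (0 : ℝ) (3 * N * a)) :=
    Metric.isClosed_closedBall.measurableSet
  apply Measurable.mul
  · exact (measurable_one.indicator h).comp measurable_fst
  · exact (Measurable.indicator (by fun_prop) h).comp measurable_snd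

theorem lintegral_one_div {a b : ℝ} (ha : 0 < a) (hab : a ≤ b) :
    ∫⁻ t in Set.Ioc a b, ENNReal.ofReal (1 / t) = ENNReal.ofReal (Real.log (b / a)) := by
  have hi : IntervalIntegrable (fun t : ℝ => 1 / t) volume a b := by
    apply intervalIntegral.intervalIntegrable_one_div _ (by fun_prop)
    intro x hx
    rw [Set.uIcc_of_le hab] at hx
    exact (ha.trans_le hx.1).ne'
  rw [← integral_one_div_of_pos ha (ha.trans_le hab), intervalIntegral.integral_of_le hab,
    ofReal_integral_eq_lintegral_ofReal]
  · exact (intervalIntegrable_iff_integrableOn_Ioc_of_le hab).1 hi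
  · filter_upwards [ae_restrict_mem measurableSet_Ioc] with t ht
    have : 0 < t := ha.trans ht.1
    simp only [Pi.zero_apply]; positivity

theorem lintegral_one_div_add_abs {a T : ℝ} (ha : 0 < a) (hT : 0 ≤ T) :
    ∫⁻ t in Metric.closedBall (0 : ℝ) T, ENNReal.ofReal (1 / (a + |t|)) ≤
      2 * ENNReal.ofReal (Real.log ((a + T) / a)) := by
  set f : ℝ → ℝ≥0∞ := fun t => (Set.Ioc a (a + T)).indicator (fun t => ENNReal.ofReal (1 / t)) t
  have hf : ∫⁻ t, f t = ENNReal.ofReal (Real.log ((a + T) / a)) := by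
    rw [lintegral_indicator measurableSet_Ioc, lintegral_one_div ha (by linarith)]
  have hfm : Measurable f := Measurable.indicator (by fun_prop) measurableSet_Ioc
  rw [← lintegral_indicator Metric.isClosed_closedBall.measurableSet]
  calc _ ≤ ∫⁻ t, (f (a + t) + f (a - t)) := by
        apply lintegral_mono_ae
        have h0 : ∀ᵐ t : ℝ, t ≠ 0 := by simp [ae_iff]
        filter_upwards [h0] with t ht
        by_cases hm : t ∈ Metric.closedBall (0 : ℝ) T
        · rw [Set.indicator_of_mem hm]
          rw [mem_closedBall_zero_iff, Real.norm_eq_abs] at hm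
          rcases lt_or_gt_of_ne ht with h | h
          · rw [abs_of_neg h] at hm ⊢
            have hmem : a - t ∈ Set.Ioc a (a + T) := ⟨by linarith, by linarith⟩
            refine le_trans ?_ le_add_self
            simp only [f]
            rw [Set.indicator_of_mem hmem, ← sub_eq_add_neg]
          · rw [abs_of_pos h] at hm ⊢
            have hmem : a + t ∈ Set.Ioc a (a + T) := ⟨by linarith, by linarith⟩
            refine le_trans ?_ le_self_add
            simp only [f]
            rw [Set.indicator_of_mem hmem]
        · rw [Set.indicator_of_notMem hm]; positivity
    _ = _ := by
        rw [lintegral_add_left (by fun_prop), lintegral_add_left_eq_self f a,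
          lintegral_sub_left_eq_self f a, hf, two_mul]

/-- The cutoff at `3 * N * a` limits the integral of `a / (a + |t|)` to a logarithm of `N`. This is
the logarithm in the weak type (2,2) bound. -/
theorem lintegral_overlapKernel_le {N a : ℝ} (hN : 0 ≤ N) (ha : 0 < a) (c : Plane)
    (b : OrthonormalBasis (Fin 2) ℝ Plane) :
    ∫⁻ x, overlapKernel N a (frameCoords c b x) ≤
      ENNReal.ofReal (N * a ^ 2) * ENNReal.ofReal (72 * Real.log (1 + 3 * N)) := by
  have hm : MeasurableSet (Metric.closedBall (0 : ℝ) (3 * N * a)) :=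
    Metric.isClosed_closedBall.measurableSet
  rw [(measurePreserving_frameCoords c b).lintegral_comp (measurable_overlapKernel N a),
    Measure.volume_eq_prod]
  unfold overlapKernel
  rw [lintegral_prod_mul (measurable_one.indicator hm).aemeasurable
    (Measurable.indicator (by fun_prop) hm).aemeasurable,
    lintegral_indicator hm, lintegral_indicator hm]
  have h1 : ∫⁻ t in Metric.closedBall (0 : ℝ) (3 * N * a), ENNReal.ofReal (6 * a / (a + |t|)) ≤
      ENNReal.ofReal (6 * a) * (2 * ENNReal.ofReal (Real.log ((a + 3 * N * a) / a))) := by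
    rw [← one_mul (6 * a)]
    simp_rw [one_mul, div_eq_mul_one_div (6 * a), ENNReal.ofReal_mul (show 0 ≤ 6 * a by positivity)]
    rw [lintegral_const_mul _ (by fun_prop)]
    gcongr
    exact lintegral_one_div_add_abs ha (by positivity)
  have h2 : (a + 3 * N * a) / a = 1 + 3 * N := by field_simp
  have hlog : 0 ≤ Real.log (1 + 3 * N) := Real.log_nonneg (by linarith)
  calc _ ≤ ENNReal.ofReal (2 * (3 * N * a)) *
        (ENNReal.ofReal (6 * a) * (2 * ENNReal.ofReal (Real.log ((a + 3 * N * a) / a)))) := by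
        gcongr
        simp [Real.volume_closedBall]
    _ = _ := by
        rw [h2, ← ENNReal.ofReal_ofNat 2, ← ENNReal.ofReal_mul (by positivity),
          ← ENNReal.ofReal_mul (by positivity), ← ENNReal.ofReal_mul (by positivity),
          ← ENNReal.ofReal_mul (by positivity)]
        congr 1; ring

/-- The disjoint pieces linearise the covering: each point is assigned to one rectangle containing
it, so no selection of a sparse subfamily is needed. -/
theorem exists_measurable_partition {α ι : Type*} [MeasurableSpace α] (t : Finset ι)
    (R : ι → Set α) (hR : ∀ i, MeasurableSet (R i)) :
    ∃ E : ι → Set α, (∀ i, MeasurableSet (E i)) ∧ (∀ i, E i ⊆ R i) ∧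
      (t : Set ι).PairwiseDisjoint E ∧ ⋃ i ∈ t, E i = ⋃ i ∈ t, R i := by
  classical
  induction t using Finset.induction_on with
  | empty => exact ⟨R, hR, fun _ => subset_rfl, by simp, by simp⟩
  | insert j t hj ih =>
    obtain ⟨E, hE, hER, hd, hU⟩ := ih
    have hne : ∀ i ∈ t, i ≠ j := fun i hi h => hj (h ▸ hi)
    refine ⟨fun i => if i = j then R j \ ⋃ i ∈ t, R i else E i, ?_, ?_, ?_, ?_⟩
    · intro i
      dsimp only
      split_ifs
      · exact (hR j).diff (Finset.measurableSet_biUnion _ fun i _ => hR i)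
      · exact hE i
    · intro i
      dsimp only
      split_ifs with h
      · rw [h]; exact Set.sdiff_subset
      · exact hER i
    · have hdj : ∀ i ∈ t, Disjoint (E i) (R j \ ⋃ i ∈ t, R i) := by
        intro i hi
        rw [← hU]
        exact Set.disjoint_sdiff_right.mono_left (Set.subset_biUnion_of_mem (u := E) hi)
      intro i hi k hk hik
      simp only [Finset.coe_insert, Set.mem_insert_iff, Finset.mem_coe] at hi hk
      simp only [Function.onFun]
      rcases hi with rfl | hi <;> rcases hk with rfl | hk
      · exact absurd rfl hik
      · rw [if_pos rfl, if_neg (hne k hk)]; exact (hdj k hk).symm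
      · rw [if_pos rfl, if_neg (hne i hi)]; exact hdj i hi
      · rw [if_neg (hne i hi), if_neg (hne k hk)]; exact hd hi hk hik
    · rw [Finset.set_biUnion_insert, Finset.set_biUnion_insert, if_pos rfl]
      have : ⋃ i ∈ t, (if i = j then R j \ ⋃ i ∈ t, R i else E i) = ⋃ i ∈ t, R i := by
        rw [← hU]
        exact Set.iUnion₂_congr fun i hi => by rw [if_neg (hne i hi)]
      rw [this, Set.sdiff_union_self]

/-! ### Weak type estimates for finite families of rectangles. -/

section Covering

variable {ι : Type*} {N : ℝ} {t : Finset ι} {c : ι → Plane}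
  {b : ι → OrthonormalBasis (Fin 2) ℝ Plane} {a : ι → ℝ} {f : Plane → ℝ≥0∞} {l : ℝ≥0∞}

theorem volume_planeRectangle_ne_zero (hN : 1 ≤ N) {r : ℝ} (hr : 0 < r) (z : Plane)
    (d : OrthonormalBasis (Fin 2) ℝ Plane) : volume (planeRectangle N z d r) ≠ 0 := by
  rw [volume_planeRectangle (by linarith) hr.le]
  simp only [ne_eq, ENNReal.ofReal_eq_zero, not_le]
  positivity

theorem volume_planeRectangle_ne_top (hN : 1 ≤ N) {r : ℝ} (hr : 0 < r) (z : Plane)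
    (d : OrthonormalBasis (Fin 2) ℝ Plane) : volume (planeRectangle N z d r) ≠ ∞ := by
  rw [volume_planeRectangle (by linarith) hr.le]
  exact ENNReal.ofReal_ne_top

/-- The weak type `(1, 1)` inequality for finite families, by the Vitali covering lemma. -/
theorem mul_volume_biUnion_planeRectangle_le (hN : 1 ≤ N) (ha : ∀ i, 0 < a i)
    (h : ∀ i ∈ t, l * volume (planeRectangle N (c i) (b i) (a i)) ≤
      ∫⁻ x in planeRectangle N (c i) (b i) (a i), f x) :
    l * volume (⋃ i ∈ t, planeRectangle N (c i) (b i) (a i)) ≤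
      ENNReal.ofReal (16 * Real.pi * N) * ∫⁻ x, f x := by
  classical
  -- The lemma is applied to balls of radius `N * a i` containing the rectangles. Replacing a
  -- rectangle by such a ball costs the factor `N`.
  obtain ⟨u, hut, hdis, hcov⟩ :=
    Vitali.exists_disjoint_subfamily_covering_enlargement_closedBall (t : Set ι) c
      (fun i => N * a i) (∑ i ∈ t, N * a i)
      (fun i hi => Finset.single_le_sum (f := fun i => N * a i)
        (fun j _ => by have := ha j; positivity) hi) 4 (by norm_num)
  lift u to Finset ι using t.finite_toSet.subset hut
  have hsub : ⋃ i ∈ t, planeRectangle N (c i) (b i) (a i) ⊆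
      ⋃ i ∈ u, Metric.closedBall (c i) (4 * (N * a i)) := by
    intro x hx
    simp only [Set.mem_iUnion] at hx ⊢
    obtain ⟨i, hi, hx⟩ := hx
    obtain ⟨j, hj, hij⟩ := hcov i hi
    exact ⟨j, hj, hij (planeRectangle_subset_closedBall hN (ha i).le _ _ hx)⟩
  have hvol : ∀ i, volume (Metric.closedBall (c i) (4 * (N * a i))) =
      ENNReal.ofReal (16 * Real.pi * N) * volume (planeRectangle N (c i) (b i) (a i)) := by
    intro i
    have := ha i
    rw [EuclideanSpace.volume_closedBall_fin_two, volume_planeRectangle (by linarith) this.le,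
      ← ENNReal.ofReal_pow (by positivity), ← ENNReal.ofReal_mul (by positivity),
      ← ENNReal.ofReal_mul (by positivity)]
    congr 1; ring
  calc l * volume (⋃ i ∈ t, planeRectangle N (c i) (b i) (a i))
      ≤ l * ∑ i ∈ u, volume (Metric.closedBall (c i) (4 * (N * a i))) := by
        gcongr
        exact (measure_mono hsub).trans (measure_biUnion_finset_le _ _)
    _ = ENNReal.ofReal (16 * Real.pi * N) *
        ∑ i ∈ u, l * volume (planeRectangle N (c i) (b i) (a i)) := by
        simp_rw [hvol, Finset.mul_sum]
        exact Finset.sum_congr rfl fun i _ => by ring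
    _ ≤ ENNReal.ofReal (16 * Real.pi * N) *
        ∑ i ∈ u, ∫⁻ x in planeRectangle N (c i) (b i) (a i), f x := by
        gcongr with i hi
        exact h i (hut hi)
    _ ≤ _ := by
        gcongr
        rw [← lintegral_biUnion_finset _ (fun i _ => measurableSet_planeRectangle _ _ _ _)]
        · exact setLIntegral_le_lintegral _ _
        · exact hdis.mono_on fun i _ => planeRectangle_subset_closedBall hN (ha i).le _ _

/-- The overlaps with the smaller rectangles of a family, weighted by the proportions of
disjoint parts, are controlled by the kernel. -/
theorem sum_overlap_le (hN : 1 ≤ N) (ha : ∀ i, 0 < a i) {E : ι → Set Plane}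
    (hE : ∀ i, MeasurableSet (E i)) (hER : ∀ i, E i ⊆ planeRectangle N (c i) (b i) (a i))
    (hd : (t : Set ι).PairwiseDisjoint E) (i : ι) :
    ∑ j ∈ t with a j ≤ a i, volume (E j) / volume (planeRectangle N (c j) (b j) (a j)) *
        volume (planeRectangle N (c i) (b i) (a i) ∩ planeRectangle N (c j) (b j) (a j)) ≤
      volume (planeRectangle N (c i) (b i) (a i)) *
        ENNReal.ofReal (72 * Real.log (1 + 3 * N)) := by
  have hle : ∀ j ∈ t.filter (fun j => a j ≤ a i),
      volume (E j) / volume (planeRectangle N (c j) (b j) (a j)) *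
        volume (planeRectangle N (c i) (b i) (a i) ∩ planeRectangle N (c j) (b j) (a j)) ≤
      ∫⁻ x in E j, overlapKernel N (a i) (frameCoords (c i) (b i) x) := by
    intro j hj
    rw [Finset.mem_filter] at hj
    -- The weighted overlap is the integral over `E j` of the constant `|R i ∩ R j| / |R j|`, which
    -- the kernel dominates at every point of `E j`.
    rw [ENNReal.mul_comm_div, mul_comm, ← setLIntegral_const]
    apply setLIntegral_mono' (hE j)
    intro x hx
    apply ENNReal.div_le_of_le_mul'
    exact volume_inter_le_overlapKernel hN (ha j) hj.2 _ _ _ _ (hER j hx)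
  refine (Finset.sum_le_sum hle).trans ?_
  rw [← lintegral_biUnion_finset _ (fun i _ => hE i)]
  · refine (setLIntegral_le_lintegral _ _).trans ?_
    rw [volume_planeRectangle (by linarith) (ha i).le]
    exact lintegral_overlapKernel_le (by linarith) (ha i) _ _
  · exact hd.subset fun j hj => (Finset.mem_filter.1 hj).1

/-- The weak type `(2, 2)` inequality for finite families. -/
theorem sq_mul_volume_biUnion_planeRectangle_le (hN : 1 ≤ N) (ha : ∀ i, 0 < a i)
    (hf : Measurable f)
    (h : ∀ i ∈ t, l * volume (planeRectangle N (c i) (b i) (a i)) ≤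
      ∫⁻ x in planeRectangle N (c i) (b i) (a i), f x) :
    l ^ 2 * volume (⋃ i ∈ t, planeRectangle N (c i) (b i) (a i)) ≤
      ENNReal.ofReal (144 * Real.log (1 + 3 * N)) * ∫⁻ x, f x ^ 2 := by
  set R : ι → Set Plane := fun i => planeRectangle N (c i) (b i) (a i) with hR
  have hRm : ∀ i, MeasurableSet (R i) := fun i => measurableSet_planeRectangle _ _ _ _
  have hR0 : ∀ i, volume (R i) ≠ 0 := fun i => volume_planeRectangle_ne_zero hN (ha i) _ _
  have hRt : ∀ i, volume (R i) ≠ ∞ := fun i => volume_planeRectangle_ne_top hN (ha i) _ _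
  obtain ⟨E, hE, hER, hd, hU⟩ := exists_measurable_partition t R hRm
  set w : ι → ℝ≥0∞ := fun i => volume (E i) / volume (R i) with hw
  -- The dual function: its integral equals the measure `M` of the union, and pairing it with `f`
  -- gives at least `l * M`.
  set G : Plane → ℝ≥0∞ := fun x => ∑ i ∈ t, w i * (R i).indicator 1 x with hG
  have hGm : Measurable G :=
    Finset.measurable_sum _ fun i _ => (measurable_one.indicator (hRm i)).const_mul _
  set M := volume (⋃ i ∈ t, R i) with hM
  have hMsum : M = ∑ i ∈ t, volume (E i) := by
    rw [hM, ← hU, measure_biUnion_finset hd fun i _ => hE i]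
  have hMt : M ≠ ∞ := by
    refine ((measure_biUnion_finset_le _ _).trans_lt ?_).ne
    exact ENNReal.sum_lt_top.2 fun i _ => (hRt i).lt_top
  have hwR : ∀ i, w i * volume (R i) = volume (E i) := fun i =>
    ENNReal.div_mul_cancel (hR0 i) (hRt i)
  have h1 : l * M ≤ ∫⁻ x, (f * G) x := by
    calc l * M = ∑ i ∈ t, w i * (l * volume (R i)) := by
          rw [hMsum, Finset.mul_sum]
          exact Finset.sum_congr rfl fun i _ => by rw [← hwR i]; ring
      _ ≤ ∑ i ∈ t, w i * ∫⁻ x in R i, f x := by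
          gcongr with i hi
          exact h i hi
      _ = ∫⁻ x, (f * G) x := by
          simp only [Pi.mul_apply, hG, Finset.mul_sum]
          rw [lintegral_finsetSum _ fun i _ => by
            exact hf.mul ((measurable_one.indicator (hRm i)).const_mul _)]
          refine Finset.sum_congr rfl fun i _ => ?_
          rw [← lintegral_indicator (hRm i), ← lintegral_const_mul _ (hf.indicator (hRm i))]
          refine lintegral_congr fun x => ?_
          by_cases hx : x ∈ R i <;> simp [hx, mul_comm]
  set T : ι → ι → ℝ≥0∞ := fun i j => w i * w j * volume (R i ∩ R j) with hT
  set Λ := ENNReal.ofReal (72 * Real.log (1 + 3 * N)) with hΛ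
  have h2 : ∫⁻ x, G x ^ 2 = ∑ i ∈ t, ∑ j ∈ t, T i j := by
    have hG2 : ∀ x, G x ^ 2 = ∑ i ∈ t, ∑ j ∈ t, w i * w j * (R i ∩ R j).indicator 1 x := by
      intro x
      rw [sq, hG, Finset.sum_mul_sum]
      refine Finset.sum_congr rfl fun i _ => Finset.sum_congr rfl fun j _ => ?_
      rw [Set.inter_indicator_one, Pi.mul_apply]; ring
    have hm : ∀ i j, Measurable fun x => w i * w j * (R i ∩ R j).indicator (1 : Plane → ℝ≥0∞) x :=
      fun i j => (measurable_one.indicator ((hRm i).inter (hRm j))).const_mul _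
    simp_rw [hG2]
    rw [lintegral_finsetSum _ fun i _ => Finset.measurable_sum _ fun j _ => hm i j]
    refine Finset.sum_congr rfl fun i _ => ?_
    rw [lintegral_finsetSum _ fun j _ => hm i j]
    refine Finset.sum_congr rfl fun j _ => ?_
    rw [lintegral_const_mul _ (measurable_one.indicator ((hRm i).inter (hRm j))),
      lintegral_indicator_one ((hRm i).inter (hRm j))]
  have h3 : ∑ i ∈ t, ∑ j ∈ t with a j ≤ a i, T i j ≤ Λ * M := by
    rw [hMsum, Finset.mul_sum]
    refine Finset.sum_le_sum fun i _ => ?_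
    calc ∑ j ∈ t with a j ≤ a i, T i j
        = w i * ∑ j ∈ t with a j ≤ a i, w j * volume (R i ∩ R j) := by
          rw [Finset.mul_sum]
          exact Finset.sum_congr rfl fun j _ => by simp only [hT]; ring
      _ ≤ w i * (volume (R i) * Λ) := by
          gcongr
          exact sum_overlap_le hN ha hE hER hd i
      _ = _ := by rw [← mul_assoc, hwR, mul_comm]
  have h4 : ∑ i ∈ t, ∑ j ∈ t with a i ≤ a j, T i j = ∑ i ∈ t, ∑ j ∈ t with a j ≤ a i, T i j := by
    simp_rw [Finset.sum_filter]
    rw [Finset.sum_comm]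
    refine Finset.sum_congr rfl fun i _ => Finset.sum_congr rfl fun j _ => ?_
    simp only [hT, Set.inter_comm (R i), mul_comm (w i)]
  have h5 : ∫⁻ x, G x ^ 2 ≤ ENNReal.ofReal (144 * Real.log (1 + 3 * N)) * M := by
    have hlog : 0 ≤ Real.log (1 + 3 * N) := Real.log_nonneg (by linarith)
    calc ∫⁻ x, G x ^ 2 ≤ (∑ i ∈ t, ∑ j ∈ t with a j ≤ a i, T i j) +
          ∑ i ∈ t, ∑ j ∈ t with a i ≤ a j, T i j := by
          rw [h2, ← Finset.sum_add_distrib]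
          refine Finset.sum_le_sum fun i _ => ?_
          simp_rw [Finset.sum_filter]
          rw [← Finset.sum_add_distrib]
          refine Finset.sum_le_sum fun j _ => ?_
          rcases le_total (a j) (a i) with hij | hij
          · rw [if_pos hij]; exact le_self_add
          · rw [if_pos hij]; exact le_add_self
      _ ≤ Λ * M + Λ * M := by rw [h4]; gcongr
      _ = _ := by
          rw [← add_mul, ← ENNReal.ofReal_add (by positivity) (by positivity)]
          congr 2; ring
  rcases eq_or_ne M 0 with hM0 | hM0
  · rw [hM0]; simp
  have h6 := ENNReal.lintegral_mul_le_Lp_mul_Lq volume Real.HolderConjugate.two_two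
    hf.aemeasurable hGm.aemeasurable
  simp only [ENNReal.rpow_two] at h6
  have h7 : (l * M) ^ 2 ≤ (∫⁻ x, f x ^ 2) * ∫⁻ x, G x ^ 2 := by
    refine (pow_le_pow_left₀ bot_le (h1.trans h6) 2).trans_eq ?_
    rw [mul_pow, ← ENNReal.rpow_two, ← ENNReal.rpow_two, ← ENNReal.rpow_mul, ← ENNReal.rpow_mul]
    norm_num
  have h8 : l ^ 2 * M * M ≤ ENNReal.ofReal (144 * Real.log (1 + 3 * N)) * (∫⁻ x, f x ^ 2) * M := by
    calc l ^ 2 * M * M = (l * M) ^ 2 := by ring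
      _ ≤ (∫⁻ x, f x ^ 2) * (ENNReal.ofReal (144 * Real.log (1 + 3 * N)) * M) := by
        refine h7.trans ?_; gcongr
      _ = _ := by ring
  exact (ENNReal.mul_le_mul_iff_left hM0 hMt).1 h8

end Covering

/-! ### The maximal operator and its weak type inequalities. -/

/-- The maximal operator over rectangles of eccentricity `N`, for nonnegative functions. -/
def rectMaximal (N : ℝ) (f : Plane → ℝ≥0∞) (x : Plane) : ℝ≥0∞ :=
  ⨆ (R : Set Plane) (_ : R ∈ eccRectangles N) (_ : x ∈ R), ⨍⁻ y in R, f y ∂volume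

theorem kakeyaMaximal_eq_rectMaximal (N : ℝ) (f : Plane → ℝ) :
    kakeyaMaximal N f = rectMaximal N fun x => ‖f x‖ₑ := rfl

section Maximal

variable {N : ℝ} {f g : Plane → ℝ≥0∞}

theorem rectMaximal_le_iff {x : Plane} {B : ℝ≥0∞} : rectMaximal N f x ≤ B ↔
    ∀ (c : Plane) (b : OrthonormalBasis (Fin 2) ℝ Plane) (a : ℝ), 0 < a →
      x ∈ planeRectangle N c b a → ⨍⁻ y in planeRectangle N c b a, f y ∂volume ≤ B := by
  simp only [rectMaximal, iSup_le_iff]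
  constructor
  · intro h c b a ha hx
    exact h _ ⟨c, b, a, ha, rfl⟩ hx
  · rintro h _ ⟨c, b, a, ha, rfl⟩ hx
    exact h c b a ha hx

theorem laverage_le_rectMaximal {x c : Plane} {b : OrthonormalBasis (Fin 2) ℝ Plane} {a : ℝ}
    (ha : 0 < a) (hx : x ∈ planeRectangle N c b a) (f : Plane → ℝ≥0∞) :
    ⨍⁻ y in planeRectangle N c b a, f y ∂volume ≤ rectMaximal N f x :=
  rectMaximal_le_iff.1 le_rfl c b a ha hx

theorem rectMaximal_mono (h : ∀ x, f x ≤ g x) (x : Plane) :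
    rectMaximal N f x ≤ rectMaximal N g x :=
  rectMaximal_le_iff.2 fun _ _ _ ha hx =>
    (lintegral_mono h).trans (laverage_le_rectMaximal ha hx g)

theorem rectMaximal_congr_ae (h : f =ᵐ[volume] g) : rectMaximal N f = rectMaximal N g := by
  ext x
  simp only [rectMaximal]
  refine iSup_congr fun R => iSup_congr fun _ => iSup_congr fun _ => ?_
  exact laverage_congr (ae_restrict_of_ae h)

theorem rectMaximal_add_le (hf : Measurable f) (x : Plane) :
    rectMaximal N (fun x => f x + g x) x ≤ rectMaximal N f x + rectMaximal N g x := by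
  refine rectMaximal_le_iff.2 fun c b a ha hx => ?_
  have : ⨍⁻ y in planeRectangle N c b a, (f y + g y) ∂volume =
      ⨍⁻ y in planeRectangle N c b a, f y ∂volume + ⨍⁻ y in planeRectangle N c b a, g y ∂volume :=
    lintegral_add_left hf _
  rw [this]
  exact add_le_add (laverage_le_rectMaximal ha hx f) (laverage_le_rectMaximal ha hx g)

theorem rectMaximal_le_of_forall_le {B : ℝ≥0∞} (h : ∀ x, f x ≤ B) (x : Plane) :
    rectMaximal N f x ≤ B := by
  refine rectMaximal_le_iff.2 fun c b a _ _ => ?_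
  rw [laverage_eq]
  refine ENNReal.div_le_of_le_mul ?_
  exact (lintegral_mono h).trans_eq (lintegral_const B)

theorem isProbabilityMeasure_planeRectangle (hN : 1 ≤ N) {a : ℝ} (ha : 0 < a) (c : Plane)
    (b : OrthonormalBasis (Fin 2) ℝ Plane) :
    IsProbabilityMeasure ((volume.restrict (planeRectangle N c b a) Set.univ)⁻¹ •
      (volume : Measure Plane).restrict (planeRectangle N c b a)) := by
  constructor
  simp only [Measure.smul_apply, smul_eq_mul, Measure.restrict_apply_univ]
  exact ENNReal.inv_mul_cancel (volume_planeRectangle_ne_zero hN ha c b)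
    (volume_planeRectangle_ne_top hN ha c b)

theorem laverage_rpow_le (hN : 1 ≤ N) {a r : ℝ} (ha : 0 < a) (hr : 1 ≤ r) (hf : Measurable f)
    (c : Plane) (b : OrthonormalBasis (Fin 2) ℝ Plane) :
    (⨍⁻ y in planeRectangle N c b a, f y ∂volume) ^ r ≤ ⨍⁻ y in planeRectangle N c b a, f y ^ r ∂volume := by
  have := isProbabilityMeasure_planeRectangle hN ha c b
  have h := eLpNorm'_le_eLpNorm'_of_exponent_le one_pos hr
    ((volume.restrict (planeRectangle N c b a) Set.univ)⁻¹ •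
      (volume : Measure Plane).restrict (planeRectangle N c b a)) hf.aestronglyMeasurable
  have h' := ENNReal.rpow_le_rpow h (zero_le_one.trans hr)
  rw [← lintegral_rpow_enorm_eq_rpow_eLpNorm' (by linarith), eLpNorm'_eq_lintegral_enorm] at h'
  simpa [laverage_eq, ENNReal.div_eq_inv_mul] using h'

/-- Jensen's inequality on each rectangle. With `s = 2` it deduces every exponent `p ≥ 2` from the
case two without worsening the constant, so no further interpolation is needed. -/
theorem rectMaximal_rpow_le (hN : 1 ≤ N) {r s : ℝ} (hr : 1 ≤ r) (hs : 0 < s) (hf : Measurable f)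
    (x : Plane) :
    rectMaximal N f x ^ (r * s) ≤ rectMaximal N (fun y => f y ^ r) x ^ s := by
  rw [ENNReal.rpow_mul]
  refine ENNReal.rpow_le_rpow ?_ hs.le
  rw [← ENNReal.le_rpow_inv_iff (by linarith)]
  refine rectMaximal_le_iff.2 fun c b a ha hx => ?_
  rw [ENNReal.le_rpow_inv_iff (by linarith)]
  exact (laverage_rpow_le hN ha hr hf c b).trans (laverage_le_rectMaximal ha hx _)

theorem lt_laverage_iff (hN : 1 ≤ N) {a : ℝ} (ha : 0 < a) (c : Plane)
    (b : OrthonormalBasis (Fin 2) ℝ Plane) (l : ℝ≥0∞) :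
    l < ⨍⁻ y in planeRectangle N c b a, f y ∂volume ↔
      l * volume (planeRectangle N c b a) < ∫⁻ y in planeRectangle N c b a, f y := by
  rw [laverage_eq, Measure.restrict_apply_univ, ENNReal.lt_div_iff_mul_lt
    (.inl (volume_planeRectangle_ne_zero hN ha c b))
    (.inl (volume_planeRectangle_ne_top hN ha c b))]

/-- The superlevel sets are unions of open rectangles contained in rectangles with large
averages. -/
theorem exists_isOpen_of_lt_rectMaximal (hN : 1 ≤ N) {l : ℝ≥0∞} {x : Plane}
    (hx : l < rectMaximal N f x) :
    ∃ (c : Plane) (b : OrthonormalBasis (Fin 2) ℝ Plane) (a : ℝ) (U : Set Plane), 0 < a ∧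
      IsOpen U ∧ x ∈ U ∧ U ⊆ planeRectangle N c b a ∧
      l * volume (planeRectangle N c b a) < ∫⁻ y in planeRectangle N c b a, f y := by
  have hx' := hx
  rw [← not_le, rectMaximal_le_iff] at hx
  push Not at hx
  obtain ⟨c, b, a, ha, hxR, hl⟩ := hx
  rw [lt_laverage_iff hN ha] at hl
  have hlt : l ≠ ∞ := hx'.ne_top
  have hN0 : 0 < N := by linarith
  have hcont : Filter.Tendsto (fun r : ℝ => l * ENNReal.ofReal (N * r ^ 2)) (nhds a)
      (nhds (l * ENNReal.ofReal (N * a ^ 2))) := by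
    apply ENNReal.Tendsto.const_mul _ (.inr hlt)
    apply ENNReal.tendsto_ofReal
    exact Continuous.tendsto (by fun_prop) a
  rw [volume_planeRectangle hN0.le ha.le] at hl
  -- A slightly larger side `r` preserves the strict inequality and puts the original closed
  -- rectangle inside an open one.
  obtain ⟨r, hr, har⟩ := ((((hcont.eventually_lt_const hl).filter_mono
    nhdsWithin_le_nhds).and self_mem_nhdsWithin : ∀ᶠ r in nhdsWithin a (Set.Ioi a), _)).exists
  have har : a < r := har
  have hr0 := ha.trans har
  refine ⟨c, b, r, frameCoords c b ⁻¹' (Metric.ball 0 (N * r / 2) ×ˢ Metric.ball 0 (r / 2)),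
    hr0, (Metric.isOpen_ball.prod Metric.isOpen_ball).preimage (continuous_frameCoords c b), ?_,
    ?_, ?_⟩
  · rw [planeRectangle_eq_preimage] at hxR
    refine Set.preimage_mono (Set.prod_mono ?_ ?_) hxR <;>
      exact Metric.closedBall_subset_ball (by gcongr)
  · rw [planeRectangle_eq_preimage]
    exact Set.preimage_mono (Set.prod_mono Metric.ball_subset_closedBall
      Metric.ball_subset_closedBall)
  · rw [volume_planeRectangle hN0.le hr0.le]
    refine hr.trans_le (lintegral_mono_set ?_)
    rw [planeRectangle_eq_preimage, planeRectangle_eq_preimage]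
    exact Set.preimage_mono (Set.prod_mono (Metric.closedBall_subset_closedBall (by gcongr))
      (Metric.closedBall_subset_closedBall (by gcongr)))

theorem isOpen_lt_rectMaximal (hN : 1 ≤ N) (l : ℝ≥0∞) : IsOpen {x | l < rectMaximal N f x} := by
  rw [isOpen_iff_forall_mem_open]
  intro x hx
  obtain ⟨c, b, a, U, ha, hU, hxU, hUR, hl⟩ := exists_isOpen_of_lt_rectMaximal hN hx
  exact ⟨U, fun y hy => ((lt_laverage_iff hN ha c b l).2 hl).trans_le
    (laverage_le_rectMaximal ha (hUR hy) f), hU, hxU⟩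

theorem measurable_rectMaximal (hN : 1 ≤ N) : Measurable (rectMaximal N f) :=
  measurable_of_Ioi fun l => (isOpen_lt_rectMaximal hN l).measurableSet

/-- Estimates of unions of finitely many rectangles pass to the superlevel sets. -/
theorem mul_volume_lt_rectMaximal_le (hN : 1 ≤ N) {l m B : ℝ≥0∞}
    (h : ∀ (t : Finset {i : Plane × OrthonormalBasis (Fin 2) ℝ Plane × ℝ // 0 < i.2.2}),
      (∀ i ∈ t, l * volume (planeRectangle N i.1.1 i.1.2.1 i.1.2.2) ≤
        ∫⁻ x in planeRectangle N i.1.1 i.1.2.1 i.1.2.2, f x) →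
      m * volume (⋃ i ∈ t, planeRectangle N i.1.1 i.1.2.1 i.1.2.2) ≤ B) :
    m * volume {x | l < rectMaximal N f x} ≤ B := by
  classical
  rw [(isOpen_lt_rectMaximal hN l).measure_eq_iSup_isCompact, ENNReal.mul_iSup]
  refine iSup_le fun S => ?_
  rw [ENNReal.mul_iSup]
  refine iSup_le fun hS => ?_
  rw [ENNReal.mul_iSup]
  refine iSup_le fun hSc => ?_
  have hex : ∀ x : S, ∃ i : {i : Plane × OrthonormalBasis (Fin 2) ℝ Plane × ℝ // 0 < i.2.2},
      ∃ U : Set Plane, IsOpen U ∧ (x : Plane) ∈ U ∧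
        U ⊆ planeRectangle N i.1.1 i.1.2.1 i.1.2.2 ∧
        l * volume (planeRectangle N i.1.1 i.1.2.1 i.1.2.2) <
          ∫⁻ y in planeRectangle N i.1.1 i.1.2.1 i.1.2.2, f y := by
    rintro ⟨x, hx⟩
    obtain ⟨c, b, a, U, ha, hU⟩ := exists_isOpen_of_lt_rectMaximal hN (hS hx)
    exact ⟨⟨(c, b, a), ha⟩, U, hU⟩
  choose i U hU hxU hUR hl using hex
  obtain ⟨s, hs⟩ := hSc.elim_finite_subcover U hU fun x hx => Set.mem_iUnion.2 ⟨⟨x, hx⟩, hxU _⟩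
  refine le_trans ?_ (h (s.image i) ?_)
  · gcongr
    refine hs.trans ?_
    intro x hx
    simp only [Set.mem_iUnion] at hx ⊢
    obtain ⟨y, hy, hxy⟩ := hx
    exact ⟨i y, Finset.mem_image_of_mem i hy, hUR y hxy⟩
  · intro j hj
    obtain ⟨y, _, rfl⟩ := Finset.mem_image.1 hj
    exact (hl y).le

theorem mul_volume_lt_rectMaximal_le_lintegral (hN : 1 ≤ N) (l : ℝ≥0∞) :
    l * volume {x | l < rectMaximal N f x} ≤
      ENNReal.ofReal (16 * Real.pi * N) * ∫⁻ x, f x := by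
  refine mul_volume_lt_rectMaximal_le (m := l) hN fun t ht => ?_
  exact mul_volume_biUnion_planeRectangle_le (t := t) (f := f) (l := l)
    (c := fun i => i.1.1) (b := fun i => i.1.2.1) (a := fun i => i.1.2.2) hN (fun i => i.2) ht

theorem sq_mul_volume_lt_rectMaximal_le (hN : 1 ≤ N) (hf : Measurable f) (l : ℝ≥0∞) :
    l ^ 2 * volume {x | l < rectMaximal N f x} ≤
      ENNReal.ofReal (144 * Real.log (1 + 3 * N)) * ∫⁻ x, f x ^ 2 := by
  refine mul_volume_lt_rectMaximal_le (m := l ^ 2) hN fun t ht => ?_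
  exact sq_mul_volume_biUnion_planeRectangle_le (t := t) (f := f) (l := l)
    (c := fun i => i.1.1) (b := fun i => i.1.2.1) (a := fun i => i.1.2.2) hN (fun i => i.2) hf ht

end Maximal

/-! ### From weak to strong type. -/

/-- The layer cake formula for the square, as an inequality. -/
theorem ENNReal.sq_le_lintegral_ite_lt (u : ℝ≥0∞) :
    u ^ 2 ≤ ∫⁻ s in Set.Ioi (0 : ℝ), if ENNReal.ofReal s < u then ENNReal.ofReal (2 * s) else 0 := by
  have key : ∀ r : ℝ≥0, (r : ℝ≥0∞) ≤ u → (r : ℝ≥0∞) ^ 2 ≤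
      ∫⁻ s in Set.Ioi (0 : ℝ), if ENNReal.ofReal s < u then ENNReal.ofReal (2 * s) else 0 := by
    intro r hr
    have h1 : (r : ℝ≥0∞) ^ 2 = ∫⁻ s in Set.Ioc (0 : ℝ) r, ENNReal.ofReal (2 * s) := by
      rw [← ofReal_integral_eq_lintegral_ofReal, ← intervalIntegral.integral_of_le r.coe_nonneg]
      · rw [intervalIntegral.integral_const_mul, integral_id, ← ENNReal.ofReal_coe_nnreal,
          ← ENNReal.ofReal_pow r.coe_nonneg]
        congr 1; ring
      · exact (Continuous.integrableOn_Icc (by fun_prop)).mono_set Set.Ioc_subset_Icc_self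
      · filter_upwards [ae_restrict_mem measurableSet_Ioc] with s hs
        have := hs.1
        simp only [Pi.zero_apply]; positivity
    rw [h1, ← setLIntegral_congr (Ioo_ae_eq_Ioc (a := (0 : ℝ)) (b := (r : ℝ)) (μ := volume))]
    calc _ = ∫⁻ s in Set.Ioo (0 : ℝ) r,
          if ENNReal.ofReal s < u then ENNReal.ofReal (2 * s) else 0 := by
          refine setLIntegral_congr_fun measurableSet_Ioo fun s hs => ?_
          have : ENNReal.ofReal s < u := by
            refine lt_of_lt_of_le ?_ hr
            rw [← ENNReal.ofReal_coe_nnreal]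
            exact (ENNReal.ofReal_lt_ofReal_iff (hs.1.trans hs.2)).2 hs.2
          simp only [this, if_true]
      _ ≤ _ := lintegral_mono_set fun s hs => hs.1
  induction u with
  | top =>
    have : ∀ n : ℕ, (n : ℝ≥0∞) ≤
        ∫⁻ s in Set.Ioi (0 : ℝ), if ENNReal.ofReal s < ∞ then ENNReal.ofReal (2 * s) else 0 := by
      intro n
      refine le_trans ?_ (key n le_top)
      norm_cast
      nlinarith [Nat.le_self_pow (n := 2) (by norm_num) n]
    refine le_of_eq_of_le (ENNReal.top_pow two_ne_zero) ?_
    rw [top_le_iff]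
    exact ENNReal.eq_top_of_forall_nnreal_le fun r => by
      obtain ⟨n, hn⟩ := exists_nat_ge r
      exact le_trans (by exact_mod_cast hn) (this n)
  | coe r => exact key r le_rfl

section Interpolation

variable {N : ℝ} {f : Plane → ℝ≥0∞}

theorem lintegral_rectMaximal_sq_le_levels (hN : 1 ≤ N) :
    ∫⁻ x, rectMaximal N f x ^ 2 ≤ ∫⁻ s in Set.Ioi (0 : ℝ),
      ENNReal.ofReal (2 * s) * volume {x | ENNReal.ofReal s < rectMaximal N f x} := by
  have hK : Measurable (rectMaximal N f) := measurable_rectMaximal hN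
  have hm : Measurable (Function.uncurry fun (x : Plane) (s : ℝ) =>
      if ENNReal.ofReal s < rectMaximal N f x then ENNReal.ofReal (2 * s) else 0) := by
    unfold Function.uncurry
    exact Measurable.ite (measurableSet_lt (by fun_prop) (by fun_prop)) (by fun_prop) (by fun_prop)
  calc _ ≤ ∫⁻ x, ∫⁻ s in Set.Ioi (0 : ℝ),
        if ENNReal.ofReal s < rectMaximal N f x then ENNReal.ofReal (2 * s) else 0 :=
        lintegral_mono fun x => ENNReal.sq_le_lintegral_ite_lt _
    _ = ∫⁻ s in Set.Ioi (0 : ℝ), ∫⁻ x,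
        if ENNReal.ofReal s < rectMaximal N f x then ENNReal.ofReal (2 * s) else 0 :=
        lintegral_lintegral_swap hm.aemeasurable
    _ = _ := by
        refine lintegral_congr fun s => ?_
        have : MeasurableSet {x | ENNReal.ofReal s < rectMaximal N f x} :=
          (isOpen_lt_rectMaximal hN _).measurableSet
        rw [← setLIntegral_const, ← lintegral_indicator this]
        refine lintegral_congr fun x => ?_
        simp only [Set.indicator_apply, Set.mem_ofPred_eq]

/-- Splitting `f` at two heights and using both weak type inequalities. -/
theorem mul_volume_lt_rectMaximal_le_add (hN : 1 ≤ N) (hf : Measurable f) {s : ℝ} (hs : 0 < s) :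
    ENNReal.ofReal (2 * s) * volume {x | ENNReal.ofReal s < rectMaximal N f x} ≤
      ENNReal.ofReal (4608 * Real.log (1 + 3 * N)) * (ENNReal.ofReal (1 / s) *
        ∫⁻ x, {x | ENNReal.ofReal (s / 2) < f x ∧ f x ≤ ENNReal.ofReal (N * s)}.indicator
          (fun x => f x ^ 2) x) +
      ENNReal.ofReal (128 * Real.pi * N) *
        ∫⁻ x, {x | ENNReal.ofReal (N * s) < f x}.indicator f x := by
  have hlog : 0 ≤ Real.log (1 + 3 * N) := Real.log_nonneg (by linarith)
  set A := {x | ENNReal.ofReal (s / 2) < f x ∧ f x ≤ ENNReal.ofReal (N * s)} with hA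
  set B := {x | ENNReal.ofReal (N * s) < f x} with hB
  have hAm : MeasurableSet A :=
    (measurableSet_lt measurable_const hf).inter (measurableSet_le hf measurable_const)
  have hBm : MeasurableSet B := measurableSet_lt measurable_const hf
  have hgm : Measurable (A.indicator f) := hf.indicator hAm
  have hhm : Measurable (B.indicator f) := hf.indicator hBm
  have hdec : ∀ x, f x ≤ ENNReal.ofReal (s / 2) + (A.indicator f x + B.indicator f x) := by
    intro x
    by_cases hxB : x ∈ B
    · rw [Set.indicator_of_mem hxB]; exact le_add_left (le_add_left le_rfl)
    by_cases hxA : x ∈ A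
    · rw [Set.indicator_of_mem hxA]; exact le_add_left (le_add_right le_rfl)
    · refine le_add_right ?_
      by_contra hcon
      exact hxA ⟨not_le.1 hcon, not_lt.1 hxB⟩
  have hK : ∀ x, rectMaximal N f x ≤ ENNReal.ofReal (s / 2) +
      (rectMaximal N (A.indicator f) x + rectMaximal N (B.indicator f) x) := by
    intro x
    refine (rectMaximal_mono hdec x).trans ((rectMaximal_add_le measurable_const x).trans ?_)
    gcongr
    · exact rectMaximal_le_of_forall_le (fun _ => le_rfl) x
    · exact rectMaximal_add_le hgm x
  -- Values up to `s / 2` contribute at most `s / 2` to the maximal function, so one of the other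
  -- two parts must contribute more than `s / 4`.
  have hsub : {x | ENNReal.ofReal s < rectMaximal N f x} ⊆
      {x | ENNReal.ofReal (s / 4) < rectMaximal N (A.indicator f) x} ∪
      {x | ENNReal.ofReal (s / 4) < rectMaximal N (B.indicator f) x} := by
    intro x hx
    by_contra hcon
    simp only [Set.mem_union, Set.mem_ofPred_eq, not_or, not_lt] at hcon hx
    refine absurd ((hK x).trans (add_le_add_right (add_le_add hcon.1 hcon.2) _)) (not_le.2 ?_)
    rw [← ENNReal.ofReal_add (by positivity) (by positivity),
      ← ENNReal.ofReal_add (by positivity) (by positivity)]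
    convert hx using 2; ring
  have h1 := mul_volume_lt_rectMaximal_le_lintegral (f := B.indicator f) hN (ENNReal.ofReal (s / 4))
  have h2 := sq_mul_volume_lt_rectMaximal_le hN hgm (ENNReal.ofReal (s / 4))
  have hsq : ∀ x, A.indicator f x ^ 2 = A.indicator (fun x => f x ^ 2) x := by
    intro x
    by_cases hx : x ∈ A <;> simp [hx]
  simp_rw [hsq] at h2
  set VA := volume {x | ENNReal.ofReal (s / 4) < rectMaximal N (A.indicator f) x}
  set VB := volume {x | ENNReal.ofReal (s / 4) < rectMaximal N (B.indicator f) x}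
  calc _ ≤ ENNReal.ofReal (2 * s) * (VA + VB) := by
        gcongr
        exact (measure_mono hsub).trans (measure_union_le _ _)
    _ = ENNReal.ofReal (32 / s) * (ENNReal.ofReal (s / 4) ^ 2 * VA) +
        ENNReal.ofReal 8 * (ENNReal.ofReal (s / 4) * VB) := by
        rw [← ENNReal.ofReal_pow (by positivity), ← mul_assoc, ← mul_assoc,
          ← ENNReal.ofReal_mul (by positivity), ← ENNReal.ofReal_mul (by positivity), mul_add]
        congr 3
        · field_simp; ring
        · ring
    _ ≤ ENNReal.ofReal (32 / s) * (ENNReal.ofReal (144 * Real.log (1 + 3 * N)) *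
          ∫⁻ x, A.indicator (fun x => f x ^ 2) x) +
        ENNReal.ofReal 8 * (ENNReal.ofReal (16 * Real.pi * N) * ∫⁻ x, B.indicator f x) := by
        gcongr
    _ = _ := by
        have := Real.pi_pos
        rw [← mul_assoc, ← mul_assoc, ← mul_assoc, ← ENNReal.ofReal_mul (by positivity),
          ← ENNReal.ofReal_mul (by positivity), ← ENNReal.ofReal_mul (by positivity)]
        congr 3 <;> ring

/-- A value `u` is active only for levels `s` in `[u / N, 2u]`, whose `ds / s` measure is `log
(2N)`. This is the second logarithm. -/
theorem lintegral_levels_middle_le (hN : 1 ≤ N) (u : ℝ≥0∞) :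
    ∫⁻ s in Set.Ioi (0 : ℝ), (if ENNReal.ofReal (s / 2) < u ∧ u ≤ ENNReal.ofReal (N * s) then
      ENNReal.ofReal (1 / s) else 0) ≤ ENNReal.ofReal (Real.log (2 * N)) := by
  have hN0 : 0 < N := by linarith
  rcases eq_or_ne u ∞ with rfl | hu
  · simp
  lift u to ℝ≥0 using hu
  rcases eq_or_ne u 0 with rfl | hu
  · simp
  have hu0 : (0 : ℝ) < u := by exact_mod_cast pos_iff_ne_zero.2 hu
  have hlt : (u : ℝ) / N ≤ 2 * u := by rw [div_le_iff₀ hN0]; nlinarith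
  calc _ ≤ ∫⁻ s, (Set.Icc ((u : ℝ) / N) (2 * u)).indicator (fun s => ENNReal.ofReal (1 / s)) s := by
        rw [← lintegral_indicator measurableSet_Ioi]
        refine lintegral_mono fun s => ?_
        by_cases hs : s ∈ Set.Ioi (0 : ℝ)
        · rw [Set.indicator_of_mem hs]
          have hs : 0 < s := hs
          split_ifs with h
          · rw [← ENNReal.ofReal_coe_nnreal, ENNReal.ofReal_lt_ofReal_iff hu0,
              ENNReal.ofReal_le_ofReal_iff (by positivity)] at h
            have hmem : s ∈ Set.Icc ((u : ℝ) / N) (2 * u) :=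
              ⟨by rw [div_le_iff₀ hN0]; linarith [h.2], by linarith [h.1]⟩
            rw [Set.indicator_of_mem hmem]
          · positivity
        · rw [Set.indicator_of_notMem hs]; positivity
    _ = _ := by
        rw [lintegral_indicator measurableSet_Icc,
          ← setLIntegral_congr (Ioc_ae_eq_Icc (μ := volume)),
          lintegral_one_div (by positivity) hlt]
        congr 2; field_simp

/-- Only levels `s < u / N` contribute. The gain `1 / N` cancels the constant of the weak type (1,1)
inequality. -/
theorem lintegral_levels_top_le (hN : 1 ≤ N) (u : ℝ≥0∞) :
    ∫⁻ s in Set.Ioi (0 : ℝ), (if ENNReal.ofReal (N * s) < u then u else 0) ≤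
      ENNReal.ofReal (1 / N) * u ^ 2 := by
  have hN0 : 0 < N := by linarith
  rcases eq_or_ne u ∞ with rfl | hu
  · rw [ENNReal.top_pow two_ne_zero, ENNReal.mul_top]
    · exact le_top
    · simpa using hN0
  lift u to ℝ≥0 using hu
  calc _ ≤ ∫⁻ s, (Set.Icc (0 : ℝ) (1 / N * u)).indicator (fun _ => (u : ℝ≥0∞)) s := by
        rw [← lintegral_indicator measurableSet_Ioi]
        refine lintegral_mono fun s => ?_
        by_cases hs : s ∈ Set.Ioi (0 : ℝ)
        · rw [Set.indicator_of_mem hs]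
          have hs : 0 < s := hs
          split_ifs with h
          · rw [← ENNReal.ofReal_coe_nnreal, ENNReal.ofReal_lt_ofReal_iff_of_nonneg
              (by positivity)] at h
            have hmem : s ∈ Set.Icc (0 : ℝ) (1 / N * u) := by
              refine ⟨hs.le, ?_⟩
              rw [one_div, ← div_eq_inv_mul, le_div_iff₀ hN0]; linarith
            rw [Set.indicator_of_mem hmem]
          · positivity
        · rw [Set.indicator_of_notMem hs]; positivity
    _ = _ := by
        rw [lintegral_indicator measurableSet_Icc, setLIntegral_const, Real.volume_Icc, sub_zero,
          ENNReal.ofReal_mul (by positivity), ENNReal.ofReal_coe_nnreal]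
        ring

/-- The strong type `(2, 2)` inequality. -/
theorem lintegral_rectMaximal_sq_le (hN : 1 ≤ N) (hf : Measurable f) :
    ∫⁻ x, rectMaximal N f x ^ 2 ≤
      ENNReal.ofReal (4608 * Real.log (1 + 3 * N) * Real.log (2 * N) + 128 * Real.pi) *
        ∫⁻ x, f x ^ 2 := by
  have hN0 : 0 < N := by linarith
  have hlog : 0 ≤ Real.log (1 + 3 * N) := Real.log_nonneg (by linarith)
  have hlog' : 0 ≤ Real.log (2 * N) := Real.log_nonneg (by linarith)
  have hpi := Real.pi_pos
  set P : ℝ → Plane → ℝ≥0∞ := fun s x =>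
    (if ENNReal.ofReal (s / 2) < f x ∧ f x ≤ ENNReal.ofReal (N * s) then
      ENNReal.ofReal (1 / s) else 0) * f x ^ 2 with hP
  set Q : ℝ → Plane → ℝ≥0∞ := fun s x => if ENNReal.ofReal (N * s) < f x then f x else 0 with hQ
  have hP0 : Measurable fun q : ℝ × Plane =>
      if ENNReal.ofReal (q.1 / 2) < f q.2 ∧ f q.2 ≤ ENNReal.ofReal (N * q.1) then
      ENNReal.ofReal (1 / q.1) else 0 := by
    have h1 : MeasurableSet {q : ℝ × Plane | ENNReal.ofReal (q.1 / 2) < f q.2} :=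
      measurableSet_lt (by fun_prop) (by fun_prop)
    have h2 : MeasurableSet {q : ℝ × Plane | f q.2 ≤ ENNReal.ofReal (N * q.1)} :=
      measurableSet_le (by fun_prop) (by fun_prop)
    exact Measurable.ite (h1.inter h2) (by fun_prop) (by fun_prop)
  have hPm : Measurable (Function.uncurry P) := hP0.mul (by fun_prop)
  have hQm : Measurable (Function.uncurry Q) :=
    Measurable.ite (measurableSet_lt (by fun_prop) (by fun_prop)) (by fun_prop) (by fun_prop)
  have hlev : ∀ s ∈ Set.Ioi (0 : ℝ),
      ENNReal.ofReal (2 * s) * volume {x | ENNReal.ofReal s < rectMaximal N f x} ≤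
      ENNReal.ofReal (4608 * Real.log (1 + 3 * N)) * (∫⁻ x, P s x) +
        ENNReal.ofReal (128 * Real.pi * N) * ∫⁻ x, Q s x := by
    intro s hs
    refine (mul_volume_lt_rectMaximal_le_add hN hf hs).trans_eq ?_
    congr 2
    swap
    · simp only [hQ, Set.indicator_apply, Set.mem_ofPred_eq]
    rw [← lintegral_const_mul]
    · refine lintegral_congr fun x => ?_
      simp only [hP, Set.indicator_apply, Set.mem_ofPred_eq]
      split_ifs <;> simp
    · exact (hf.pow_const 2).indicator ((measurableSet_lt measurable_const hf).inter
        (measurableSet_le hf measurable_const))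
  calc _ ≤ _ := lintegral_rectMaximal_sq_le_levels hN
    _ ≤ ∫⁻ s in Set.Ioi (0 : ℝ), (ENNReal.ofReal (4608 * Real.log (1 + 3 * N)) * (∫⁻ x, P s x) +
        ENNReal.ofReal (128 * Real.pi * N) * ∫⁻ x, Q s x) :=
        setLIntegral_mono' measurableSet_Ioi hlev
    _ = ENNReal.ofReal (4608 * Real.log (1 + 3 * N)) *
          (∫⁻ x, ∫⁻ s in Set.Ioi (0 : ℝ), P s x) +
        ENNReal.ofReal (128 * Real.pi * N) * ∫⁻ x, ∫⁻ s in Set.Ioi (0 : ℝ), Q s x := by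
        have hPi : Measurable fun s => ∫⁻ x, P s x := hPm.lintegral_prod_right'
        have hQi : Measurable fun s => ∫⁻ x, Q s x := hQm.lintegral_prod_right'
        rw [lintegral_add_left (hPi.const_mul _), lintegral_const_mul _ hPi,
          lintegral_const_mul _ hQi,
          lintegral_lintegral_swap hPm.aemeasurable, lintegral_lintegral_swap hQm.aemeasurable]
    _ ≤ ENNReal.ofReal (4608 * Real.log (1 + 3 * N)) *
          (∫⁻ x, ENNReal.ofReal (Real.log (2 * N)) * f x ^ 2) +
        ENNReal.ofReal (128 * Real.pi * N) * ∫⁻ x, ENNReal.ofReal (1 / N) * f x ^ 2 := by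
        gcongr with x x
        · simp only [hP]
          rw [lintegral_mul_const]
          · gcongr
            exact lintegral_levels_middle_le hN _
          · exact hP0.comp (measurable_id.prodMk measurable_const)
        · exact lintegral_levels_top_le hN _
    _ = _ := by
        rw [lintegral_const_mul _ (hf.pow_const 2), lintegral_const_mul _ (hf.pow_const 2),
          ← mul_assoc, ← mul_assoc, ← ENNReal.ofReal_mul (by positivity),
          ← ENNReal.ofReal_mul (by positivity), ← add_mul,
          ← ENNReal.ofReal_add (by positivity) (by positivity)]
        congr 3
        field_simp

/-- The strong type `(p, p)` inequality for `2 ≤ p`, with a power of the logarithm that does not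
depend on `p`. -/
theorem lintegral_rectMaximal_rpow_le (hN : 2 ≤ N) {p : ℝ} (hp : 2 ≤ p) (hf : Measurable f) :
    ∫⁻ x, rectMaximal N f x ^ p ≤
      ENNReal.ofReal (30000 * Real.log N ^ 2) * ∫⁻ x, f x ^ p := by
  have hL : 1 / 2 < Real.log N :=
    lt_of_lt_of_le (by linarith [Real.log_two_gt_d9]) (Real.log_le_log two_pos hN)
  have h1 : Real.log (1 + 3 * N) ≤ 3 * Real.log N := by
    have h := Real.log_le_log (by linarith) (show 1 + 3 * N ≤ N ^ 3 by nlinarith [sq_nonneg (N - 2)])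
    rwa [Real.log_pow] at h
  have h2 : Real.log (2 * N) ≤ 2 * Real.log N := by
    have h := Real.log_le_log (by linarith) (show 2 * N ≤ N ^ 2 by nlinarith)
    rwa [Real.log_pow] at h
  calc _ ≤ ∫⁻ x, rectMaximal N (fun y => f y ^ (p / 2)) x ^ 2 := by
        refine lintegral_mono fun x => ?_
        have := rectMaximal_rpow_le (N := N) (by linarith) (by linarith : 1 ≤ p / 2) two_pos hf x
        rwa [div_mul_cancel₀ _ two_ne_zero, ENNReal.rpow_two] at this
    _ ≤ _ := lintegral_rectMaximal_sq_le (by linarith) (hf.pow_const _)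
    _ ≤ _ := by
        -- The leading term is at most `27648 * log² N`. Since `π < 4` and `log N > 1/2`, the term
        -- `128π` is at most `2048 * log² N`.
        gcongr ENNReal.ofReal ?_ * ?_
        · have h3 := Real.pi_lt_four
          have h4 : Real.log (1 + 3 * N) * Real.log (2 * N) ≤ 3 * Real.log N * (2 * Real.log N) := by
            gcongr
            exact Real.log_nonneg (by linarith)
          nlinarith
        · refine le_of_eq (lintegral_congr fun x => ?_)
          rw [← ENNReal.rpow_two, ← ENNReal.rpow_mul, div_mul_cancel₀ _ two_ne_zero]

end Interpolation

/-! ### Regularity of the exponent and change of exponents. -/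

section Exponent

variable {N : ℝ} {p : Plane → ℝ} {cN pm pp pinf cinf : ℝ}

theorem ModifiedLogHolder.continuous (hN : 1 < N) (hp : ∀ x, 1 ≤ p x)
    (h : ModifiedLogHolder N p cN) : Continuous p := by
  have hinv : Continuous fun x => 1 / p x := by
    rw [continuous_iff_continuousAt]
    intro x
    rw [← continuousWithinAt_compl_self, ContinuousWithinAt, tendsto_iff_norm_sub_tendsto_zero]
    have hnorm : Filter.Tendsto (fun y : Plane => ‖y - x‖) (nhdsWithin x {x}ᶜ)
        (nhdsWithin 0 (Set.Ioi 0)) := tendsto_norm_sub_self_nhdsNE x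
    have hsq : Filter.Tendsto (fun y : Plane => N / ‖y - x‖ ^ 2) (nhdsWithin x {x}ᶜ)
        Filter.atTop := by
      have h1 : Filter.Tendsto (fun r : ℝ => N / r ^ 2) (nhdsWithin 0 (Set.Ioi 0))
          Filter.atTop := by
        have h2 := ((Filter.tendsto_pow_atTop two_ne_zero).comp
          (tendsto_inv_nhdsGT_zero (𝕜 := ℝ))).const_mul_atTop (show 0 < N by linarith)
        refine h2.congr fun r => ?_
        simp [div_eq_mul_inv]
      exact h1.comp hnorm
    have hlog := Real.tendsto_log_atTop.comp hsq
    refine squeeze_zero' (g := fun y => cN * Real.log N / Real.log (N / ‖y - x‖ ^ 2))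
      (Filter.Eventually.of_forall fun _ => norm_nonneg _) ?_ (hlog.const_div_atTop _)
    have hsmall : ∀ᶠ y in nhdsWithin x {x}ᶜ, ‖y - x‖ < Real.sqrt N :=
      (hnorm.mono_right nhdsWithin_le_nhds).eventually_lt_const (Real.sqrt_pos.2 (by linarith))
    filter_upwards [hsmall, hlog.eventually_gt_atTop 0] with y hy hy'
    have hy' : 0 < Real.log (N / ‖y - x‖ ^ 2) := hy'
    rw [le_div_iff₀ hy']
    exact h.2 y x hy
  have := hinv.inv₀ fun x => by have := hp x; positivity
  convert this using 1
  ext x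
  simp

/-- A set of full measure is dense, so continuity turns the almost everywhere bound into one at
every point, including the minimisers of `p` on rectangles. -/
theorem le_of_expInf_eq (hc : Continuous p) (h : expInf p = (pm : EReal)) (x : Plane) :
    pm ≤ p x := by
  have hae : ∀ᵐ y : Plane, pm ≤ p y := by
    have h1 := ae_essInf_le (μ := (volume : Measure Plane)) (f := fun y => (p y : EReal))
    filter_upwards [h1] with y hy
    rw [show essInf (fun y => (p y : EReal)) volume = pm from h] at hy
    exact_mod_cast hy
  have hd := Measure.dense_of_ae hae
  have hcl : IsClosed {y | pm ≤ p y} := isClosed_le continuous_const hc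
  have : x ∈ {y | pm ≤ p y} := by
    rw [← hcl.closure_eq, hd.closure_eq]; trivial
  exact this

theorem le_of_expSup_eq (hc : Continuous p) (h : expSup p = (pp : EReal)) (x : Plane) :
    p x ≤ pp := by
  have hae : ∀ᵐ y : Plane, p y ≤ pp := by
    have h1 := ae_le_essSup (μ := (volume : Measure Plane)) (f := fun y => (p y : EReal))
    filter_upwards [h1] with y hy
    rw [show essSup (fun y => (p y : EReal)) volume = pp from h] at hy
    exact_mod_cast hy
  have hd := Measure.dense_of_ae hae
  have hcl : IsClosed {y | p y ≤ pp} := isClosed_le hc continuous_const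
  have : x ∈ {y | p y ≤ pp} := by
    rw [← hcl.closure_eq, hd.closure_eq]; trivial
  exact this

/-- Far from the origin `p` approaches `pinf`, so the lower bound passes to the limit. In particular
the L^`pinf` estimate is available for the small values. -/
theorem LogHolderAtInfinity.le_limit (h : LogHolderAtInfinity p pinf cinf)
    (hp : ∀ x, pm ≤ p x) : pm ≤ pinf := by
  by_contra! hlt
  have h0 : 0 < pm - pinf := by linarith
  obtain ⟨e, he⟩ := exists_ne (0 : Plane)
  set R := Real.exp ((cinf + 1) / (pm - pinf)) with hR
  have hx := h ((R / ‖e‖) • e)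
  have hn : ‖(R / ‖e‖) • e‖ = R := by
    rw [norm_smul, norm_div, norm_norm, div_mul_cancel₀ _ (norm_ne_zero_iff.2 he), hR,
      Real.norm_eq_abs, Real.abs_exp]
  rw [hn] at hx
  have hlog : (cinf + 1) / (pm - pinf) ≤ Real.log (Real.exp 1 + R) := by
    rw [Real.le_log_iff_exp_le (by positivity)]
    linarith [Real.exp_pos 1]
  rw [div_le_iff₀ h0] at hlog
  have hlog0 : 0 ≤ Real.log (Real.exp 1 + R) := by
    apply Real.log_nonneg
    linarith [Real.add_one_le_exp 1, Real.exp_pos ((cinf + 1) / (pm - pinf))]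
  have habs : pm - pinf ≤ |p ((R / ‖e‖) • e) - pinf| :=
    le_trans (by linarith [hp ((R / ‖e‖) • e)]) (le_abs_self _)
  nlinarith

/-- Here `N * a ^ 2` is the area of a rectangle, `d` the distance of two of its points and `δ` the
difference of their reciprocal exponents. As `d ^ 2` is at most about `N` times the area, `N / d ^
2` is at least about the reciprocal area, which explains the normalisation of the modified
condition. -/
theorem inv_area_rpow_le {a d δ : ℝ} (hN : 2 ≤ N) (hc : 0 ≤ cN) (ha : 0 < a) (hd : 0 ≤ d)
    (hda : d ^ 2 ≤ (N ^ 2 + 1) * a ^ 2) (hδ : 0 ≤ δ) (hδ1 : δ ≤ 1) (hdδ : d = 0 → δ = 0)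
    (h : d < Real.sqrt N → δ * Real.log (N / d ^ 2) ≤ cN * Real.log N) :
    ((N * a ^ 2)⁻¹) ^ δ ≤ 5 / 4 * N ^ cN := by
  have hN0 : 0 < N := by linarith
  have hlogN : 0 ≤ Real.log N := Real.log_nonneg (by linarith)
  have hl54 : 0 ≤ Real.log (5 / 4) := Real.log_nonneg (by norm_num)
  have hv : 0 < N * a ^ 2 := by positivity
  suffices hs : Real.log (N * a ^ 2)⁻¹ * δ ≤ Real.log (5 / 4) + Real.log N * cN by
    rw [Real.rpow_def_of_pos (by positivity), Real.rpow_def_of_pos hN0]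
    calc _ ≤ Real.exp (Real.log (5 / 4) + Real.log N * cN) := Real.exp_le_exp.2 hs
      _ = _ := by rw [Real.exp_add, Real.exp_log (by norm_num)]
  rcases hd.eq_or_lt with hd0 | hd0
  · rw [hdδ hd0.symm]; simp only [mul_zero]; positivity
  -- For `N ≥ 2`, `N ^ 2 + 1 ≤ 5/4 * N ^ 2`. Area below `4/5` therefore forces `d < √N`, where the
  -- hypothesis applies. For larger area, `δ ≤ 1` gives the bound `5/4` directly.
  rcases le_or_gt (4 / 5) (N * a ^ 2) with hva | hva
  · have h1 : Real.log (N * a ^ 2)⁻¹ ≤ Real.log (5 / 4) := by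
      apply Real.log_le_log (by positivity)
      rw [inv_le_comm₀ hv (by norm_num)]; linarith
    nlinarith [mul_le_mul_of_nonneg_right h1 hδ, mul_nonneg hlogN hc]
  · have h1 : d ^ 2 ≤ 5 / 4 * (N * (N * a ^ 2)) := by nlinarith [sq_nonneg a]
    have h2 : d < Real.sqrt N := by
      apply Real.lt_sqrt_of_sq_lt
      nlinarith
    have h3 : Real.log (N * a ^ 2)⁻¹ ≤ Real.log (5 / 4) + Real.log (N / d ^ 2) := by
      rw [← Real.log_mul (by norm_num) (by positivity)]
      apply Real.log_le_log (by positivity)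
      rw [inv_le_iff_one_le_mul₀ hv, mul_div_assoc', div_mul_eq_mul_div, one_le_div (by positivity)]
      linarith
    nlinarith [mul_le_mul_of_nonneg_right h3 hδ, h h2]

/-- Passing from a variable exponent to a constant one for large values: on a rectangle the
exponent oscillates little compared with the logarithm of the area. -/
theorem rectMaximal_rpow_le_of_large (hN : 2 ≤ N) (hp : ModifiedLogHolder N p cN) (hpm : 1 ≤ pm)
    (hle : ∀ x, pm ≤ p x) {F : Plane → ℝ≥0∞} (hF : Measurable F) (hF1 : ∀ x, F x = 0 ∨ 1 ≤ F x)
    (hint : ∫⁻ x, F x ^ p x ≤ 1) (x : Plane) :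
    rectMaximal N F x ^ p x ≤ ENNReal.ofReal (5 / 4 * N ^ cN) ^ p x *
      rectMaximal N (fun y => F y ^ (p y / pm)) x ^ pm := by
  have hcont : Continuous p := hp.continuous (by linarith) fun x => hpm.trans (hle x)
  have hpx : 0 < p x := by linarith [hle x]
  rw [← ENNReal.le_rpow_inv_iff hpx]
  refine rectMaximal_le_iff.2 fun c b a ha hx => ?_
  rw [ENNReal.le_rpow_inv_iff hpx]
  set R := planeRectangle N c b a with hR
  have hRc : IsCompact R := (isCompact_closedBall c (N * a)).of_isClosed_subset
    (isClosed_planeRectangle _ _ _ _) (planeRectangle_subset_closedBall (by linarith) ha.le _ _)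
  -- With the least exponent on `R`, values `F z ≥ 1` satisfy `F z ^ (p y / pm) ≤ F z ^ (p z / pm)`,
  -- so Jensen's inequality can be applied with a constant power.
  obtain ⟨y, hy, hmin⟩ := hRc.exists_isMinOn ⟨x, hx⟩ hcont.continuousOn
  have hr : pm ≤ p y := hle y
  have hr0 : 0 < p y := by linarith
  have hpm0 : 0 < pm := by linarith
  set A := ⨍⁻ z in R, F z ^ (p z / pm) ∂volume with hA
  have hFp : Measurable fun z => F z ^ (p z / pm) := hF.pow (hcont.measurable.div_const _)
  have h1 : (⨍⁻ z in R, F z ∂volume) ^ (p y / pm) ≤ A := by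
    refine (laverage_rpow_le (by linarith) ha ((one_le_div hpm0).2 hr) hF c b).trans ?_
    rw [hA, laverage_eq, laverage_eq]
    gcongr 1
    refine setLIntegral_mono hFp fun z hz => ?_
    rcases hF1 z with h0 | h0
    · rw [h0, ENNReal.zero_rpow_of_pos (by positivity)]; positivity
    · exact ENNReal.rpow_le_rpow_of_exponent_le h0 (by gcongr; exact hmin hz)
  have h2 : A ^ pm ≤ ENNReal.ofReal ((N * a ^ 2)⁻¹) := by
    refine (laverage_rpow_le (by linarith) ha hpm hFp c b).trans ?_
    rw [laverage_eq, Measure.restrict_apply_univ, volume_planeRectangle (by linarith) ha.le,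
      ENNReal.ofReal_inv_of_pos (by positivity), ← one_div]
    gcongr
    refine (setLIntegral_le_lintegral _ _).trans (le_trans (le_of_eq ?_) hint)
    refine lintegral_congr fun z => ?_
    rw [← ENNReal.rpow_mul, div_mul_cancel₀ _ hpm0.ne']
  set δ := 1 / p y - 1 / p x with hδ
  have hδ0 : 0 ≤ δ := sub_nonneg.2 (one_div_le_one_div_of_le hr0 (hmin hx))
  have hδ1 : δ ≤ 1 := by
    have : 1 / p y ≤ 1 := by rw [div_le_one hr0]; linarith
    have : 0 < 1 / p x := by positivity
    linarith
  have h3 : ((N * a ^ 2)⁻¹) ^ δ ≤ 5 / 4 * N ^ cN := by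
    refine inv_area_rpow_le (d := ‖x - y‖) hN hp.1.le ha (norm_nonneg _)
      (norm_sub_sq_le_of_mem_planeRectangle hx hy) hδ0 hδ1 ?_ ?_
    · intro h0
      rw [norm_eq_zero, sub_eq_zero] at h0
      rw [hδ, h0, sub_self]
    · intro hlt
      have := hp.2 x y hlt
      rwa [abs_sub_comm, abs_of_nonneg hδ0] at this
  have hexp : p x = p y / pm * (pm * (p x / p y)) := by field_simp
  have hexp' : pm * (p x / p y) = pm + pm * (δ * p x) := by rw [hδ]; field_simp; ring
  calc (⨍⁻ z in R, F z ∂volume) ^ p x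
      = ((⨍⁻ z in R, F z ∂volume) ^ (p y / pm)) ^ (pm * (p x / p y)) := by
        rw [← ENNReal.rpow_mul, ← hexp]
    _ ≤ A ^ (pm * (p x / p y)) := by gcongr
    _ = A ^ pm * ((A ^ pm) ^ δ) ^ p x := by
        rw [hexp', ENNReal.rpow_add_of_nonneg _ _ hpm0.le (by positivity), ENNReal.rpow_mul A pm,
          ENNReal.rpow_mul]
    _ ≤ A ^ pm * (ENNReal.ofReal (5 / 4 * N ^ cN)) ^ p x := by
        gcongr
        refine (ENNReal.rpow_le_rpow h2 hδ0).trans ?_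
        rw [ENNReal.ofReal_rpow_of_nonneg (by positivity) hδ0]
        exact ENNReal.ofReal_le_ofReal h3
    _ ≤ _ := by
        rw [mul_comm]
        gcongr
        exact laverage_le_rectMaximal ha hx _

/-- Changing exponents, for values below one, at the price of an integrable error. -/
theorem rpow_le_mul_rpow_add_of_le_one {u : ℝ≥0∞} (hu : u ≤ 1) {q s c ρ : ℝ} (hq : 2 ≤ q)
    (hs : 2 ≤ s) (hρ : 0 ≤ ρ) (h : |q - s| * Real.log (Real.exp 1 + ρ) ≤ c) :
    u ^ q ≤ ENNReal.ofReal (Real.exp (2 * c)) * u ^ s + ENNReal.ofReal ((1 + ρ) ^ (-4 : ℝ)) := by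
  lift u to ℝ≥0 using ne_top_of_le_ne_top ENNReal.one_ne_top hu
  have hu1 : (u : ℝ) ≤ 1 := by exact_mod_cast hu
  have hE : 1 + ρ ≤ Real.exp 1 + ρ := by linarith [Real.add_one_le_exp 1]
  have hE0 : 0 < Real.exp 1 + ρ := by linarith
  rw [← ENNReal.ofReal_coe_nnreal, ENNReal.ofReal_rpow_of_nonneg u.coe_nonneg (by linarith),
    ENNReal.ofReal_rpow_of_nonneg u.coe_nonneg (by linarith),
    ← ENNReal.ofReal_mul (by positivity), ← ENNReal.ofReal_add (by positivity) (by positivity)]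
  apply ENNReal.ofReal_le_ofReal
  -- Above this threshold `|log u| ≤ 2 log (e + ρ)`, so changing the exponent costs at most `exp
  -- (2c)`. Below it, `q ≥ 2` gives `u ^ q ≤ (e + ρ) ^ (-4)`, a decay integrable in the plane.
  rcases le_or_gt ((Real.exp 1 + ρ) ^ (-2 : ℝ)) (u : ℝ) with hlow | hlow
  · have hu0 : (0 : ℝ) < u := lt_of_lt_of_le (by positivity) hlow
    have hlogu : -Real.log u ≤ 2 * Real.log (Real.exp 1 + ρ) := by
      have := Real.log_le_log (by positivity) hlow
      rw [Real.log_rpow hE0] at this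
      linarith
    have hlogu' : Real.log u ≤ 0 := Real.log_nonpos hu0.le hu1
    have h1 : (u : ℝ) ^ (q - s) ≤ Real.exp (2 * c) := by
      rw [Real.rpow_def_of_pos hu0]
      apply Real.exp_le_exp.2
      have h2 : Real.log u * (q - s) ≤ -Real.log u * |q - s| := by
        nlinarith [neg_abs_le (q - s)]
      nlinarith [abs_nonneg (q - s)]
    have h2 : (u : ℝ) ^ q = (u : ℝ) ^ (q - s) * (u : ℝ) ^ s := by
      rw [← Real.rpow_add hu0]; congr 1; ring
    rw [h2]
    have : 0 ≤ (1 + ρ) ^ (-4 : ℝ) := by positivity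
    have h3 := mul_le_mul_of_nonneg_right h1 (Real.rpow_nonneg u.coe_nonneg s)
    linarith
  · have h1 : (u : ℝ) ^ q ≤ (u : ℝ) ^ (2 : ℝ) :=
      Real.rpow_le_rpow_of_exponent_ge' u.coe_nonneg hu1 (by norm_num) hq
    have h2 : (u : ℝ) ^ (2 : ℝ) ≤ ((Real.exp 1 + ρ) ^ (-2 : ℝ)) ^ (2 : ℝ) :=
      Real.rpow_le_rpow u.coe_nonneg hlow.le (by norm_num)
    have h3 : ((Real.exp 1 + ρ) ^ (-2 : ℝ)) ^ (2 : ℝ) = (Real.exp 1 + ρ) ^ (-4 : ℝ) := by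
      rw [← Real.rpow_mul hE0.le]; norm_num
    have h4 : (Real.exp 1 + ρ) ^ (-4 : ℝ) ≤ (1 + ρ) ^ (-4 : ℝ) :=
      Real.rpow_le_rpow_of_nonpos (by positivity) hE (by norm_num)
    have : 0 ≤ Real.exp (2 * c) * (u : ℝ) ^ s := by positivity
    linarith

end Exponent

/-! ### Estimates of the modular. -/

/-- The mass of the error term in the change of exponents. -/
def decayMass : ℝ := ∫ x : Plane, (1 + ‖x‖) ^ (-4 : ℝ)

theorem decayMass_nonneg : 0 ≤ decayMass := integral_nonneg fun x => by positivity

theorem lintegral_decay : ∫⁻ x : Plane, ENNReal.ofReal ((1 + ‖x‖) ^ (-4 : ℝ)) =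
    ENNReal.ofReal decayMass := by
  refine (ofReal_integral_eq_lintegral_ofReal (integrable_one_add_norm ?_)
    (Filter.Eventually.of_forall fun x => ?_)).symm
  · rw [finrank_euclideanSpace_fin]; norm_num
  · simp only [Pi.zero_apply]; positivity

section Modular

variable {N : ℝ} {p : Plane → ℝ} {cN pm pp pinf cinf : ℝ} {F : Plane → ℝ≥0∞}

/-- The contribution of the large values. -/
theorem lintegral_rectMaximal_large_le (hN : 2 ≤ N) (hp : ModifiedLogHolder N p cN)
    (hpm : 2 ≤ pm) (hle : ∀ x, pm ≤ p x) (hF : Measurable F) (hF1 : ∀ x, F x = 0 ∨ 1 ≤ F x)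
    (hint : ∫⁻ x, F x ^ p x ≤ 1) :
    ∫⁻ x, (rectMaximal N F x / ENNReal.ofReal (5 / 4 * N ^ cN)) ^ p x ≤
      ENNReal.ofReal (30000 * Real.log N ^ 2) := by
  have hcont : Continuous p := hp.continuous (by linarith) fun x => by linarith [hle x]
  have hFp : Measurable fun z => F z ^ (p z / pm) := hF.pow (hcont.measurable.div_const _)
  have hB : 0 < 5 / 4 * N ^ cN := by positivity
  calc _ ≤ ∫⁻ x, rectMaximal N (fun y => F y ^ (p y / pm)) x ^ pm := by
        refine lintegral_mono fun x => ?_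
        have hpx : 0 ≤ p x := by linarith [hle x]
        rw [ENNReal.div_rpow_of_nonneg _ _ hpx]
        refine ENNReal.div_le_of_le_mul' ?_
        exact rectMaximal_rpow_le_of_large hN hp (by linarith) hle hF hF1 hint x
    _ ≤ ENNReal.ofReal (30000 * Real.log N ^ 2) * ∫⁻ x, (F x ^ (p x / pm)) ^ pm :=
        lintegral_rectMaximal_rpow_le hN hpm hFp
    _ ≤ ENNReal.ofReal (30000 * Real.log N ^ 2) * 1 := by
        gcongr
        refine le_trans (le_of_eq (lintegral_congr fun z => ?_)) hint
        rw [← ENNReal.rpow_mul, div_mul_cancel₀ _ (by linarith)]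
    _ = _ := mul_one _

/-- The contribution of the small values. -/
theorem lintegral_rectMaximal_small_le (hN : 2 ≤ N) (hp : Continuous p) (hle : ∀ x, 2 ≤ p x)
    (hpinf : 2 ≤ pinf) (hinf : LogHolderAtInfinity p pinf cinf) (hF : Measurable F)
    (hF1 : ∀ x, F x ≤ 1) (hint : ∫⁻ x, F x ^ p x ≤ 1) :
    ∫⁻ x, rectMaximal N F x ^ p x ≤
      ENNReal.ofReal (Real.exp (2 * cinf) * (30000 * Real.log N ^ 2 *
        (Real.exp (2 * cinf) + decayMass)) + decayMass) := by
  have hd := decayMass_nonneg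
  have hw : Measurable fun x : Plane => ENNReal.ofReal ((1 + ‖x‖) ^ (-4 : ℝ)) := by fun_prop
  have hF2 : ∫⁻ x, F x ^ pinf ≤ ENNReal.ofReal (Real.exp (2 * cinf) + decayMass) := by
    calc _ ≤ ∫⁻ x, (ENNReal.ofReal (Real.exp (2 * cinf)) * F x ^ p x +
          ENNReal.ofReal ((1 + ‖x‖) ^ (-4 : ℝ))) := lintegral_mono fun x =>
          rpow_le_mul_rpow_add_of_le_one (hF1 x) hpinf (hle x) (norm_nonneg x)
            (by rw [abs_sub_comm]; exact hinf x)
      _ = ENNReal.ofReal (Real.exp (2 * cinf)) * (∫⁻ x, F x ^ p x) +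
          ENNReal.ofReal decayMass := by
          rw [lintegral_add_right _ hw, lintegral_const_mul _ (hF.pow hp.measurable),
            lintegral_decay]
      _ ≤ ENNReal.ofReal (Real.exp (2 * cinf)) * 1 + ENNReal.ofReal decayMass := by gcongr
      _ = _ := by rw [mul_one, ← ENNReal.ofReal_add (by positivity) hd]
  calc _ ≤ ∫⁻ x, (ENNReal.ofReal (Real.exp (2 * cinf)) * rectMaximal N F x ^ pinf +
        ENNReal.ofReal ((1 + ‖x‖) ^ (-4 : ℝ))) := lintegral_mono fun x =>
        rpow_le_mul_rpow_add_of_le_one (rectMaximal_le_of_forall_le hF1 x) (hle x) hpinf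
          (norm_nonneg x) (hinf x)
    _ = ENNReal.ofReal (Real.exp (2 * cinf)) * (∫⁻ x, rectMaximal N F x ^ pinf) +
        ENNReal.ofReal decayMass := by
        rw [lintegral_add_right _ hw, lintegral_const_mul _
          ((measurable_rectMaximal (by linarith)).pow_const _), lintegral_decay]
    _ ≤ ENNReal.ofReal (Real.exp (2 * cinf)) * (ENNReal.ofReal (30000 * Real.log N ^ 2) *
          ENNReal.ofReal (Real.exp (2 * cinf) + decayMass)) + ENNReal.ofReal decayMass := by
        gcongr
        refine (lintegral_rectMaximal_rpow_le hN hpinf hF).trans ?_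
        gcongr
    _ = _ := by
        rw [← ENNReal.ofReal_mul (by positivity), ← ENNReal.ofReal_mul (by positivity),
          ← ENNReal.ofReal_add (by positivity) hd]

/-- The constant, apart from its dependence on `N`, in the estimate of the modular. -/
def modularConst (pp cinf : ℝ) : ℝ :=
  (5 / 2) ^ pp * (30000 + Real.exp (2 * cinf) * (30000 * (Real.exp (2 * cinf) + decayMass)) +
    4 * decayMass)

theorem modularConst_nonneg (pp cinf : ℝ) : 0 ≤ modularConst pp cinf := by
  have hd := decayMass_nonneg
  unfold modularConst; positivity

/-- Large and small values are recombined by sublinearity and convexity. Since `B ≥ 1`, division by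
`B` gains at least `B ^ (-pm)` at every point, and this contains `(log N) ^ (-2)`. -/
theorem lintegral_rectMaximal_div_le_one (hN : 2 ≤ N) (hp : ModifiedLogHolder N p cN)
    (hpm : 2 ≤ pm) (hle : ∀ x, pm ≤ p x) (hge : ∀ x, p x ≤ pp)
    (hinf : LogHolderAtInfinity p pinf cinf) (hF : Measurable F)
    (hint : ∫⁻ x, F x ^ p x ≤ 1) :
    ∫⁻ x, (rectMaximal N F x / ENNReal.ofReal
      ((2 + modularConst pp cinf) * N ^ cN * Real.log N ^ (2 / pm))) ^ p x ≤ 1 := by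
  have hcont : Continuous p := hp.continuous (by linarith) fun x => by linarith [hle x]
  have hd := decayMass_nonneg
  have hM := modularConst_nonneg pp cinf
  have hpinf : 2 ≤ pinf := hinf.le_limit fun x => hpm.trans (hle x)
  have hL : 1 / 2 < Real.log N :=
    lt_of_lt_of_le (by linarith [Real.log_two_gt_d9]) (Real.log_le_log two_pos hN)
  have hL0 : 0 < Real.log N := by linarith
  have hN1 : 1 ≤ N ^ cN := Real.one_le_rpow (by linarith) hp.1.le
  set A := 2 + modularConst pp cinf with hA
  set B := A * Real.log N ^ (2 / pm) with hB
  -- `log N` can be below one, but it exceeds `1/2` and `2 / pm ≤ 1`; the summand `2` in `A`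
  -- compensates.
  have hB1 : 1 ≤ B := by
    have h1 : (1 / 2 : ℝ) ≤ (1 / 2 : ℝ) ^ (2 / pm) := by
      conv_lhs => rw [← Real.rpow_one (1 / 2 : ℝ)]
      exact Real.rpow_le_rpow_of_exponent_ge (by norm_num) (by norm_num)
        ((div_le_one (by linarith)).2 hpm)
    have h2 : (1 / 2 : ℝ) ^ (2 / pm) ≤ Real.log N ^ (2 / pm) :=
      Real.rpow_le_rpow (by norm_num) hL.le (by positivity)
    nlinarith
  set lam := A * N ^ cN * Real.log N ^ (2 / pm) with hlam
  have hlamB : lam = N ^ cN * B := by rw [hlam, hB]; ring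
  set F1 : Plane → ℝ≥0∞ := {x | 1 ≤ F x}.indicator F with hF1
  set F2 : Plane → ℝ≥0∞ := {x | F x < 1}.indicator F with hF2
  have hF1m : Measurable F1 := hF.indicator (measurableSet_le measurable_const hF)
  have hF2m : Measurable F2 := hF.indicator (measurableSet_lt hF measurable_const)
  have hsum : ∀ x, F x = F1 x + F2 x := by
    intro x
    simp only [hF1, hF2, Set.indicator_apply, Set.mem_ofPred_eq]
    rcases le_or_gt 1 (F x) with h | h
    · simp [h, not_lt.2 h]
    · simp [h, not_le.2 h]
  have hint1 : ∫⁻ x, F1 x ^ p x ≤ 1 := le_trans (lintegral_mono fun x => by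
    have : 0 ≤ p x := by linarith [hle x]
    gcongr
    rw [hsum x]; exact le_self_add) hint
  have hint2 : ∫⁻ x, F2 x ^ p x ≤ 1 := le_trans (lintegral_mono fun x => by
    have : 0 ≤ p x := by linarith [hle x]
    gcongr
    rw [hsum x]; exact le_add_self) hint
  have h1 := lintegral_rectMaximal_large_le hN hp hpm hle hF1m (fun x => by
    by_cases h : 1 ≤ F x
    · right; rwa [hF1, Set.indicator_of_mem (show x ∈ {x | 1 ≤ F x} from h)]
    · left; rw [hF1, Set.indicator_of_notMem (show x ∉ {x | 1 ≤ F x} from h)]) hint1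
  have h2 := lintegral_rectMaximal_small_le hN hcont (fun x => hpm.trans (hle x)) hpinf hinf hF2m
    (fun x => by
      by_cases h : F x < 1
      · rw [hF2, Set.indicator_of_mem (show x ∈ {x | F x < 1} from h)]; exact h.le
      · rw [hF2, Set.indicator_of_notMem (show x ∉ {x | F x < 1} from h)]; exact zero_le_one) hint2
  set Θ : ℝ := (5 / 2) ^ pp * B ^ (-pm) with hΘ
  have hΘ0 : 0 ≤ Θ := by positivity
  have hpt : ∀ x, (rectMaximal N F x / ENNReal.ofReal lam) ^ p x ≤ ENNReal.ofReal Θ *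
      ((rectMaximal N F1 x / ENNReal.ofReal (5 / 4 * N ^ cN)) ^ p x +
        rectMaximal N F2 x ^ p x) := by
    intro x
    have hpx := hle x
    have hpx' := hge x
    have hpx0 : 0 ≤ p x := by linarith
    have hfac : rectMaximal N F x / ENNReal.ofReal lam ≤ ENNReal.ofReal (5 / 4 / B) *
        (rectMaximal N F1 x / ENNReal.ofReal (5 / 4 * N ^ cN) + rectMaximal N F2 x) := by
      refine ENNReal.div_le_of_le_mul' ?_
      have h3 : rectMaximal N F x ≤ rectMaximal N F1 x + rectMaximal N F2 x := by
        simp_rw [funext hsum]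
        exact rectMaximal_add_le hF1m x
      refine h3.trans ?_
      rw [← mul_assoc, ← ENNReal.ofReal_mul (by positivity), hlamB,
        show N ^ cN * B * (5 / 4 / B) = 5 / 4 * N ^ cN by field_simp, mul_add,
        ENNReal.mul_div_cancel (by simp; positivity) ENNReal.ofReal_ne_top]
      gcongr
      refine le_mul_of_one_le_left' ?_
      rw [← ENNReal.ofReal_one]
      exact ENNReal.ofReal_le_ofReal (by linarith)
    calc _ ≤ (ENNReal.ofReal (5 / 4 / B) *
          (rectMaximal N F1 x / ENNReal.ofReal (5 / 4 * N ^ cN) + rectMaximal N F2 x)) ^ p x := by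
          gcongr
      _ = ENNReal.ofReal ((5 / 4 / B) ^ p x) *
          (rectMaximal N F1 x / ENNReal.ofReal (5 / 4 * N ^ cN) + rectMaximal N F2 x) ^ p x := by
          rw [ENNReal.mul_rpow_of_nonneg _ _ (by linarith),
            ENNReal.ofReal_rpow_of_nonneg (by positivity) (by linarith)]
      _ ≤ ENNReal.ofReal ((5 / 4 / B) ^ p x) * (2 ^ (p x - 1) *
          ((rectMaximal N F1 x / ENNReal.ofReal (5 / 4 * N ^ cN)) ^ p x +
            rectMaximal N F2 x ^ p x)) := by
          gcongr
          exact ENNReal.rpow_add_le_mul_rpow_add_rpow _ _ (by linarith)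
      _ ≤ _ := by
          rw [← mul_assoc]
          gcongr
          rw [← ENNReal.ofReal_ofNat 2, ENNReal.ofReal_rpow_of_pos two_pos,
            ← ENNReal.ofReal_mul (by positivity)]
          apply ENNReal.ofReal_le_ofReal
          have h4 : (2 : ℝ) ^ (p x - 1) ≤ 2 ^ p x :=
            Real.rpow_le_rpow_of_exponent_le (by norm_num) (by linarith)
          have h5 : (5 / 2 : ℝ) ^ p x ≤ (5 / 2) ^ pp :=
            Real.rpow_le_rpow_of_exponent_le (by norm_num) hpx'
          have h6 : B ^ (-p x) ≤ B ^ (-pm) :=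
            Real.rpow_le_rpow_of_exponent_le hB1 (by linarith)
          calc (5 / 4 / B) ^ p x * 2 ^ (p x - 1) ≤ (5 / 4 / B) ^ p x * 2 ^ p x := by gcongr
            _ = (5 / 2) ^ p x * B ^ (-p x) := by
                rw [← Real.mul_rpow (by positivity) (by norm_num), Real.rpow_neg (by positivity),
                  ← div_eq_mul_inv, ← Real.div_rpow (by norm_num) (by positivity)]
                congr 1; ring
            _ ≤ Θ := by rw [hΘ]; gcongr
  have hBpm : B ^ (-pm) ≤ A⁻¹ * (Real.log N ^ 2)⁻¹ := by
    rw [hB, Real.mul_rpow (by positivity) (by positivity), ← Real.rpow_mul hL0.le,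
      show 2 / pm * -pm = -2 by field_simp, Real.rpow_neg hL0.le, Real.rpow_two]
    gcongr
    rw [← Real.rpow_neg_one]
    exact Real.rpow_le_rpow_of_exponent_le (by linarith) (by linarith)
  have hm1 : Measurable fun x =>
      (rectMaximal N F1 x / ENNReal.ofReal (5 / 4 * N ^ cN)) ^ p x :=
    ((measurable_rectMaximal (by linarith)).div_const _).pow hcont.measurable
  have hm2 : Measurable fun x => rectMaximal N F2 x ^ p x :=
    (measurable_rectMaximal (by linarith)).pow hcont.measurable
  calc _ ≤ ∫⁻ x, ENNReal.ofReal Θ *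
        ((rectMaximal N F1 x / ENNReal.ofReal (5 / 4 * N ^ cN)) ^ p x +
          rectMaximal N F2 x ^ p x) := lintegral_mono hpt
    _ = ENNReal.ofReal Θ * ((∫⁻ x, (rectMaximal N F1 x / ENNReal.ofReal (5 / 4 * N ^ cN)) ^ p x) +
          ∫⁻ x, rectMaximal N F2 x ^ p x) := by
        rw [lintegral_const_mul' _ _ ENNReal.ofReal_ne_top, lintegral_add_left hm1]
    _ ≤ ENNReal.ofReal Θ * (ENNReal.ofReal (30000 * Real.log N ^ 2) +
        ENNReal.ofReal (Real.exp (2 * cinf) * (30000 * Real.log N ^ 2 *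
          (Real.exp (2 * cinf) + decayMass)) + decayMass)) := by gcongr
    _ ≤ 1 := by
        rw [← ENNReal.ofReal_add (by positivity) (by positivity),
          ← ENNReal.ofReal_mul hΘ0, ← ENNReal.ofReal_one]
        apply ENNReal.ofReal_le_ofReal
        have h7 : 1 ≤ 4 * Real.log N ^ 2 := by nlinarith
        -- The error term carries no logarithm, so it is inflated by `4 * log² N ≥ 1` to share the
        -- common factor.
        have h8 : decayMass ≤ 4 * decayMass * Real.log N ^ 2 := by nlinarith
        have h9 : modularConst pp cinf ≤ A := by linarith
        calc _ ≤ (5 / 2) ^ pp * (A⁻¹ * (Real.log N ^ 2)⁻¹) * (30000 * Real.log N ^ 2 +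
              (Real.exp (2 * cinf) * (30000 * Real.log N ^ 2 *
                (Real.exp (2 * cinf) + decayMass)) + 4 * decayMass * Real.log N ^ 2)) := by
              rw [hΘ]; gcongr
          _ = A⁻¹ * modularConst pp cinf := by
              unfold modularConst; field_simp; ring
          _ ≤ A⁻¹ * A := by gcongr
          _ = 1 := inv_mul_cancel₀ (by positivity)

end Modular

/-! ### From the modular to the norm. -/

section Norm

variable {N : ℝ} {p : Plane → ℝ} {f : Plane → ℝ}

theorem rectMaximal_le_mul_div {m : ℝ≥0} (hm : 0 < m) (F : Plane → ℝ≥0∞) (x : Plane) :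
    rectMaximal N F x ≤ m * rectMaximal N (fun y => F y / m) x := by
  refine rectMaximal_le_iff.2 fun c b a ha hx => ?_
  have h : ∀ y, F y = m * (F y / m) := fun y =>
    (ENNReal.mul_div_cancel (by exact_mod_cast hm.ne') ENNReal.coe_ne_top).symm
  calc _ = ⨍⁻ y in planeRectangle N c b a, m * (F y / m) ∂volume := by simp_rw [← h]
    _ = m * ⨍⁻ y in planeRectangle N c b a, F y / m ∂volume :=
        lintegral_const_mul' _ _ ENNReal.coe_ne_top
    _ ≤ _ := by
        gcongr
        exact laverage_le_rectMaximal ha hx _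

/-- A finite modular can be made at most one by dilating. -/
theorem MemVarLp.exists_varModular_le_one (hp : ∀ x, 1 ≤ p x) (hf : MemVarLp p f) :
    ∃ m : ℝ≥0, 0 < m ∧ varModular p f m ≤ 1 := by
  obtain ⟨_, l, hl, hfin⟩ := hf
  set M : ℝ≥0 := max 1 (varModular p f l).toNNReal with hM
  have hM1 : 1 ≤ M := le_max_left _ _
  have hM0 : (M : ℝ≥0∞) ≠ 0 := by exact_mod_cast (zero_lt_one.trans_le hM1).ne'
  have hle : varModular p f l ≤ M := by
    rw [← ENNReal.coe_toNNReal hfin.ne]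
    exact_mod_cast le_max_right _ _
  refine ⟨M * l, mul_pos (zero_lt_one.trans_le hM1) hl, ?_⟩
  calc varModular p f (M * l) ≤ ∫⁻ x, (M : ℝ≥0∞)⁻¹ * (‖f x‖ₑ / (l : ℝ≥0∞)) ^ p x := by
        refine lintegral_mono fun x => ?_
        have hpx : 0 ≤ p x := by linarith [hp x]
        have h1 : ‖f x‖ₑ / ((M * l : ℝ≥0) : ℝ≥0∞) = (M : ℝ≥0∞)⁻¹ * (‖f x‖ₑ / (l : ℝ≥0∞)) := by
          rw [ENNReal.coe_mul, div_eq_mul_inv, div_eq_mul_inv,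
            ENNReal.mul_inv (.inl hM0) (.inl ENNReal.coe_ne_top)]
          ring
        rw [h1, ENNReal.mul_rpow_of_nonneg _ _ hpx]
        gcongr
        refine (ENNReal.rpow_le_rpow_of_exponent_ge ?_ (hp x)).trans_eq (ENNReal.rpow_one _)
        rw [ENNReal.inv_le_one]
        exact_mod_cast hM1
    _ = (M : ℝ≥0∞)⁻¹ * varModular p f l :=
        lintegral_const_mul' _ _ (ENNReal.inv_ne_top.2 hM0)
    _ ≤ (M : ℝ≥0∞)⁻¹ * M := by gcongr
    _ = 1 := ENNReal.inv_mul_cancel hM0 ENNReal.coe_ne_top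

/-- A modular estimate on the unit ball gives the bound for the norm. -/
theorem memVarLp_and_varLpNorm_le (hN : 1 ≤ N) (hp : ∀ x, 1 ≤ p x) {A : ℝ≥0} (hA : 0 < A)
    (h : ∀ F : Plane → ℝ≥0∞, Measurable F → ∫⁻ x, F x ^ p x ≤ 1 →
      ∫⁻ x, (rectMaximal N F x / A) ^ p x ≤ 1) (hf : MemVarLp p f) :
    MemVarLp p (kakeyaMaximal N f) ∧ varLpNorm p (kakeyaMaximal N f) ≤ A * varLpNorm p f := by
  have key : ∀ m : ℝ≥0, 0 < m → varModular p f m ≤ 1 →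
      varModular p (kakeyaMaximal N f) (A * m) ≤ 1 := by
    intro m hm hfm
    have hFm : AEMeasurable (fun x => ‖f x‖ₑ / (m : ℝ≥0∞)) volume := hf.1.enorm.div_const _
    have h1 := h (hFm.mk _) hFm.measurable_mk (by
      refine le_trans (le_of_eq (lintegral_congr_ae ?_)) hfm
      filter_upwards [hFm.ae_eq_mk] with x hx
      rw [← hx])
    -- Passing to a measurable representative changes no average, so the maximal functions agree at
    -- every point.
    rw [← rectMaximal_congr_ae hFm.ae_eq_mk] at h1
    refine le_trans (lintegral_mono fun x => ?_) h1
    have hpx : 0 ≤ p x := by linarith [hp x]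
    refine ENNReal.rpow_le_rpow ?_ hpx
    rw [enorm_eq_self, kakeyaMaximal_eq_rectMaximal]
    refine ENNReal.div_le_of_le_mul' ?_
    refine (rectMaximal_le_mul_div hm _ x).trans_eq ?_
    rw [ENNReal.coe_mul, mul_assoc, mul_left_comm, ENNReal.mul_div_cancel
      (by exact_mod_cast hA.ne') ENNReal.coe_ne_top]
  refine ⟨⟨(measurable_rectMaximal hN).aestronglyMeasurable, ?_⟩, ?_⟩
  · obtain ⟨m, hm, hfm⟩ := hf.exists_varModular_le_one hp
    exact ⟨A * m, mul_pos hA hm, (key m hm hfm).trans_lt ENNReal.one_lt_top⟩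
  · unfold varLpNorm
    rw [ENNReal.mul_iInf_of_ne (by exact_mod_cast hA.ne') ENNReal.coe_ne_top]
    refine le_iInf fun m => ?_
    rw [ENNReal.mul_iInf_of_ne (by exact_mod_cast hA.ne') ENNReal.coe_ne_top]
    refine le_iInf fun hm => ?_
    rw [ENNReal.mul_iInf_of_ne (by exact_mod_cast hA.ne') ENNReal.coe_ne_top]
    refine le_iInf fun hfm => ?_
    rw [← ENNReal.coe_mul]
    exact iInf_le_of_le (A * m) (iInf_le_of_le (mul_pos hA hm) (iInf_le _ (key m hm hfm)))

end Norm

end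

/-! ### The bound for the operator norm. -/

theorem theorem1p5 (pm pp pinf cinf : ℝ) (hpm : 2 ≤ pm) (hpp : pm ≤ pp) :
    ∃ C : ℝ, 0 < C ∧
      ∀ (N : ℝ), 2 ≤ N →
      ∀ (p : Plane → ℝ), AEMeasurable p volume → (∀ x, 1 ≤ p x) →
        expInf p = (pm : EReal) → expSup p = (pp : EReal) →
        LogHolderAtInfinity p pinf cinf →
      ∀ (cN : ℝ), ModifiedLogHolder N p cN →
        BoundedOnVarLp p (kakeyaMaximal N) ∧
        varLpOpNorm p (kakeyaMaximal N) ≤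
          ENNReal.ofReal (C * N ^ (pm * cN) * Real.log N ^ (2 / pm)) := by
  have hC : 0 < 2 + modularConst pp cinf := by linarith [modularConst_nonneg pp cinf]
  refine ⟨2 + modularConst pp cinf, hC, ?_⟩
  intro N hN p _ hp1 hinf hsup hlim cN hcN
  have hcont : Continuous p := hcN.continuous (by linarith) hp1
  have hL : 0 < Real.log N := Real.log_pos (by linarith)
  set lam : ℝ := (2 + modularConst pp cinf) * N ^ (pm * cN) * Real.log N ^ (2 / pm) with hlam
  have hlam0 : 0 < lam := by positivity
  have hmod : ∀ F : Plane → ℝ≥0∞, Measurable F → ∫⁻ x, F x ^ p x ≤ 1 →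
      ∫⁻ x, (rectMaximal N F x / (lam.toNNReal : ℝ≥0∞)) ^ p x ≤ 1 := by
    intro F hF hint
    refine le_trans (lintegral_mono fun x => ?_) (lintegral_rectMaximal_div_le_one hN hcN hpm
      (le_of_expInf_eq hcont hinf) (le_of_expSup_eq hcont hsup) hlim hF hint)
    have hpx : 0 ≤ p x := by linarith [hp1 x]
    change (rectMaximal N F x / ENNReal.ofReal lam) ^ p x ≤ _
    rw [hlam]
    gcongr
    · linarith
    -- The modular estimate has the smaller power `N ^ cN`; `pm ≥ 2` and `cN > 0` give `cN ≤ pm *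
    -- cN`.
    · nlinarith [hcN.1]
  have hmain := fun (f : Plane → ℝ) (hf : MemVarLp p f) =>
    memVarLp_and_varLpNorm_le (by linarith) hp1 (Real.toNNReal_pos.2 hlam0) hmod hf
  exact ⟨⟨lam.toNNReal, hmain⟩, iInf_le_of_le lam.toNNReal (iInf_le _ fun f hf => (hmain f hf).2)⟩
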